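/- For $n\ge 0$, represent a set partition $\Pi$ of $[n]=\{1,\dots,n\}$ with blocks $B_1,\dots,B_k$, $\min B_1<\dots<\min B_k$, by its canonical sequential form $\pi=\pi_1\cdots\pi_n$, where $j\in B_{\pi_j}$. The partition contains a pattern $\tau=\tau_1\cdots\tau_m$ if $\pi$ has a subsequence order-isomorphic to $\tau$ (same strict inequalities and equalities between corresponding positions), and otherwise avoids $\tau$. For a set $T$ of patterns let $p_n(T)$ be the number of partitions of $[n]$ that avoid every pattern in $T$ (the empty partition is the only partition of $[0]$); two sets $T,R$ are (Wilf) equivalent if $p_n(T)=p_n(R)$ for all $n\ge 0$. **Theorem.** As an identity of formal Laurent series in $t$ over $\mathbb{Q}$, where the square root denotes the power series with constant term $1$ whose square is $(1-t)(1-t-4t^2)$, $$\sum_{n\ge 0}p_n(1123,1222)\,t^n=\frac{(1-t^2)\sqrt{(1-t)(1-t-4t^2)}}{2t^2(1-3t+t^2)}-\frac{1-3t-2t^2+14t^3-15t^4+3t^5}{2t^2(1-t)^2(1-3t+t^2)}.$$ The generating function $\sum_{n\ge 0}p_n(1123,1211)\,t^n$ is given by the same expression. Consequently the pattern sets $\{1123,1211\}$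 and $\{1123,1222\}$ are Wilf-equivalent. -/

import Mathlib

/-- The canonical sequential form `π₁π₂⋯πₙ` of a partition of an `n`-element linearly ordered set:
if the blocks are listed as `B₁, B₂, …` with `min B₁ < min B₂ < ⋯`, then `j` lies in the block
number `π_j`; that is, `π_j` is the number of blocks whose minimum is at most the minimum of the
block containing `j`. -/
def canonicalForm {n : ℕ} (P : Finpartition (Finset.univ : Finset (Fin n))) : Fin n → ℕ :=
  fun j => (P.parts.filter (fun B => B.min ≤ (P.part j).min)).card

/-- The word `σ` contains the pattern `τ`: some subsequence of `σ` is order-isomorphic to `τ`. -/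
def ContainsPattern {n : ℕ} (σ : Fin n → ℕ) (τ : List ℕ) : Prop :=
  ∃ f : Fin τ.length → Fin n, StrictMono f ∧ ∀ i j : Fin τ.length,
    (σ (f i) < σ (f j) ↔ τ.get i < τ.get j) ∧ (σ (f i) > σ (f j) ↔ τ.get i > τ.get j)

/-- `P_n(T)`: the partitions of an `n`-element set (the set `{1, …, n}`, modelled by `Fin n`)
that avoid every pattern in the set `T`. -/
def avoiders (T : Set (List ℕ)) (n : ℕ) : Set (Finpartition (Finset.univ : Finset (Fin n))) :=
  {P | ∀ τ ∈ T, ¬ ContainsPattern (canonicalForm P) τ}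

/-- `p_n(T)`: the number of partitions of an `n`-element set avoiding every pattern in `T`. -/
noncomputable def avoidCount (T : Set (List ℕ)) (n : ℕ) : ℕ := (avoiders T n).ncard

/-- Two sets of patterns are (Wilf) equivalent if `p_n(T) = p_n(R)` for all `n ≥ 0`. -/
def WilfEquivalent (T R : Set (List ℕ)) : Prop := ∀ n : ℕ, avoidCount T n = avoidCount R n

/-- The generating function `∑_{n ≥ 0} p_n(T) tⁿ`, as a formal power series. -/
noncomputable def avoidGenFun (T : Set (List ℕ)) : PowerSeries ℚ :=
  PowerSeries.mk (fun n => (avoidCount T n : ℚ))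

/-! Canonical forms are exactly the restricted growth words, so the task is to count words. Such a
word is either `1 ⋯ m` or `1 ⋯ m x w` with `x ≤ m`. In the second case `x` has been repeated, so
avoiding 1123 forces all letters of `x w` to be at most `m + 1` and forbids increasing triples in `x
w` (`avoids_1123_range'_append`). The second pattern only limits multiplicities in `x w`. For 1222,
letters other than 1 and `m + 1` occur at most once, and `m + 1` at most twice. For 1211, letters
below `m` occur at most once, and the subsequence `m + 1, m, m` is forbidden.

These suffixes are counted by first letter. The state is a pair of alphabets: `L`, still free, and
`U`, whose letters may no longer ascend because something smaller has occurred. Choosing `x` in `L`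
moves the larger letters of `L` to `U`; choosing `x` in `U` removes the larger letters of `U`.
Counts depend only on the sizes `j`, `k` of the alphabets, up to the few special letters.

The run `1 ⋯ m` contributes length `m`, so only the sums `∑ j, X ^ j * F j k` are needed. With
exactly this weight, the sum over lower letters obeys a two-term recurrence in `k`
(`shiftedSum_lowerSum`). The resulting systems have unique solutions, being contractions
`X`-adically, so closed forms need only be verified. They are combinations of powers of `1 + X * v`
and of `r = 1 / (1 - X)`, where `v = 1 + X ^ 2 * r * v ^ 2` is of Catalan type. Both pattern sets
lead to the same expression in `v`, and `1 - X - 2 * X ^ 2 * v` is the required square root. -/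

/-! ### Set partitions and restricted growth words -/

/-- A function is of restricted growth if its values are positive and every smaller positive value
occurs earlier. -/
def RestrictedGrowth {n : ℕ} (σ : Fin n → ℕ) : Prop :=
  ∀ i, 1 ≤ σ i ∧ ∀ c, 1 ≤ c → c < σ i → ∃ j < i, σ j = c

/-- Restricted growth of a word whose letters are preceded by the letters `1, …, m`. -/
def GrowsFrom : ℕ → List ℕ → Prop
  | _, [] => True
  | m, x :: w => 1 ≤ x ∧ x ≤ m + 1 ∧ GrowsFrom (max m x) w

/-- At the first disagreement, the smaller of the two values has already occurred in the word with
the larger one, at a position where both words agree. There one word has a repetition and the other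
has none. -/
theorem RestrictedGrowth.eq_of_ker {n : ℕ} {σ τ : Fin n → ℕ} (hσ : RestrictedGrowth σ)
    (hτ : RestrictedGrowth τ) (h : ∀ i j, σ i = σ j ↔ τ i = τ j) : σ = τ := by
  funext i
  induction i using WellFoundedLT.induction with
  | ind i ih =>
    rcases lt_trichotomy (σ i) (τ i) with hlt | heq | hgt
    · obtain ⟨j, hj, hji⟩ := (hτ i).2 _ (hσ i).1 hlt
      have h1 : σ j = σ i := (ih j hj).trans hji
      have h2 := (h j i).1 h1
      omega
    · exact heq
    · obtain ⟨j, hj, hji⟩ := (hσ i).2 _ (hτ i).1 hgt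
      have h1 : τ j = τ i := (ih j hj).symm.trans hji
      have h2 := (h j i).2 h1
      omega

/-- The rank of an element is an injective map into `{1, …, s.card}`, hence onto. -/
theorem exists_mem_card_filter_le_eq {α β : Type*} [LinearOrder β] (s : Finset α) (f : α → β)
    (hf : Set.InjOn f s) {c : ℕ} (hc : 1 ≤ c) (hcs : c ≤ s.card) :
    ∃ a ∈ s, (s.filter (fun b => f b ≤ f a)).card = c := by
  have hmaps : Set.MapsTo (fun a => (s.filter (fun b => f b ≤ f a)).card) s
      (Finset.Icc 1 s.card : Finset ℕ) := by
    intro a ha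
    simp only [Finset.coe_Icc, Set.mem_Icc]
    exact ⟨Finset.card_pos.2 ⟨a, by simpa using ha⟩, Finset.card_filter_le _ _⟩
  have hinj : Set.InjOn (fun a => (s.filter (fun b => f b ≤ f a)).card) s := by
    have key : ∀ a ∈ s, ∀ b ∈ s, f a < f b →
        (s.filter (fun c => f c ≤ f a)).card < (s.filter (fun c => f c ≤ f b)).card := by
      intro a _ b hb hab
      apply Finset.card_lt_card
      refine ⟨fun x hx => ?_, fun hsub => ?_⟩
      · simp only [Finset.mem_filter] at hx ⊢
        exact ⟨hx.1, hx.2.trans hab.le⟩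
      · have := hsub (Finset.mem_filter.2 ⟨hb, le_rfl⟩)
        exact absurd (Finset.mem_filter.1 this).2 (not_le.2 hab)
    intro a ha b hb hab
    rcases lt_trichotomy (f a) (f b) with h | h | h
    · exact absurd hab (key a ha b hb h).ne
    · exact hf ha hb h
    · exact absurd hab (key b hb a ha h).ne'
  obtain ⟨a, ha, hac⟩ := Finset.surjOn_of_injOn_of_card_le _ hmaps hinj (by simp)
    (show c ∈ ((Finset.Icc 1 s.card : Finset ℕ) : Set ℕ) by simp [hc, hcs])
  exact ⟨a, ha, hac⟩

section Partition

variable {n : ℕ} (P : Finpartition (Finset.univ : Finset (Fin n)))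

theorem Finpartition.injOn_min :
    Set.InjOn (fun B : Finset (Fin n) => B.min) (P.parts : Set (Finset (Fin n))) := by
  intro B hB C hC hBC
  obtain ⟨a, ha⟩ := Finset.min_of_nonempty (P.nonempty_of_mem_parts hB)
  have haB := Finset.mem_of_min ha
  have haC := Finset.mem_of_min ((hBC.symm.trans ha : C.min = a))
  exact P.eq_of_mem_parts hB hC haB haC

/-- A value `c` below that of `i` is the rank of a block with smaller minimum than the block of `i`;
that minimum is the earlier position carrying `c`. -/
theorem restrictedGrowth_canonicalForm : RestrictedGrowth (canonicalForm P) := by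
  intro i
  have hi : P.part i ∈ P.parts := P.part_mem.2 (Finset.mem_univ _)
  refine ⟨Finset.card_pos.2 ⟨P.part i, Finset.mem_filter.2 ⟨hi, le_rfl⟩⟩, fun c hc hci => ?_⟩
  obtain ⟨B, hB, hBc⟩ := exists_mem_card_filter_le_eq P.parts _ P.injOn_min hc
    (hci.le.trans (Finset.card_filter_le _ _))
  obtain ⟨a, ha⟩ := Finset.min_of_nonempty (P.nonempty_of_mem_parts hB)
  have haB : P.part a = B := P.part_eq_of_mem hB (Finset.mem_of_min ha)
  refine ⟨a, ?_, by rw [canonicalForm, haB]; exact hBc⟩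
  have hlt : B.min < (P.part i).min := by
    by_contra hle
    rw [not_lt] at hle
    refine absurd hci (not_lt.2 ?_)
    rw [← hBc]
    apply Finset.card_le_card
    intro D hD
    simp only [Finset.mem_filter] at hD ⊢
    exact ⟨hD.1, hD.2.trans hle⟩
  have : (a : WithTop (Fin n)) < i :=
    (ha ▸ hlt).trans_le (Finset.min_le (P.mem_part_self.2 (Finset.mem_univ _)))
  exact_mod_cast this

theorem canonicalForm_eq_iff (i j : Fin n) :
    canonicalForm P i = canonicalForm P j ↔ P.part i = P.part j := by
  refine ⟨fun h => ?_, fun h => by rw [canonicalForm, canonicalForm, h]⟩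
  have hi : P.part i ∈ P.parts := P.part_mem.2 (Finset.mem_univ _)
  have hj : P.part j ∈ P.parts := P.part_mem.2 (Finset.mem_univ _)
  have key : ∀ B ∈ P.parts, ∀ C ∈ P.parts, B.min ≤ C.min →
      (P.parts.filter (fun D => D.min ≤ B.min)).card =
        (P.parts.filter (fun D => D.min ≤ C.min)).card → B = C := by
    intro B hB C hC hle hcard
    have hsub : P.parts.filter (fun D => D.min ≤ B.min) ⊆
        P.parts.filter (fun D => D.min ≤ C.min) := by
      intro D hD
      simp only [Finset.mem_filter] at hD ⊢
      exact ⟨hD.1, hD.2.trans hle⟩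
    have heq := Finset.eq_of_subset_of_card_le hsub hcard.ge
    have : C ∈ P.parts.filter (fun D => D.min ≤ B.min) := by
      rw [heq]; exact Finset.mem_filter.2 ⟨hC, le_rfl⟩
    exact P.injOn_min hB hC (le_antisymm hle (Finset.mem_filter.1 this).2)
  rcases le_total (P.part i).min (P.part j).min with hle | hle
  · exact key _ hi _ hj hle h
  · exact (key _ hj _ hi hle h.symm).symm

theorem canonicalForm_injective :
    Function.Injective (canonicalForm (n := n)) := by
  intro P Q h
  have hpart : ∀ i, P.part i = Q.part i := by
    intro i
    ext j
    rw [P.mem_part_iff_part_eq_part (Finset.mem_univ _) (Finset.mem_univ _),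
      Q.mem_part_iff_part_eq_part (Finset.mem_univ _) (Finset.mem_univ _),
      ← canonicalForm_eq_iff, ← canonicalForm_eq_iff, h]
  have hsub : ∀ P Q : Finpartition (Finset.univ : Finset (Fin n)), (∀ i, P.part i = Q.part i) →
      P.parts ⊆ Q.parts := by
    intro P Q h B hB
    obtain ⟨a, ha⟩ := P.nonempty_of_mem_parts hB
    rw [← P.part_eq_of_mem hB ha, h]
    exact Q.part_mem.2 (Finset.mem_univ _)
  exact Finpartition.ext (Finset.Subset.antisymm (hsub P Q hpart) (hsub Q P fun i => (hpart i).symm))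

open Classical in
theorem exists_canonicalForm_eq {σ : Fin n → ℕ} (hσ : RestrictedGrowth σ) :
    ∃ P : Finpartition (Finset.univ : Finset (Fin n)), canonicalForm P = σ := by
  refine ⟨Finpartition.ofSetoid (Setoid.ker σ), ?_⟩
  refine (restrictedGrowth_canonicalForm _).eq_of_ker hσ fun i j => ?_
  rw [canonicalForm_eq_iff, ← Finpartition.mem_part_iff_part_eq_part _ (Finset.mem_univ _)
    (Finset.mem_univ _), Finpartition.mem_part_ofSetoid_iff_rel, Setoid.ker_def]
  exact eq_comm

end Partition

/-- This links the recursive definition to the positional one; values up to `m` need no witness, as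
they are taken to have occurred before. -/
theorem growsFrom_iff (m : ℕ) (w : List ℕ) : GrowsFrom m w ↔
    ∀ i (hi : i < w.length), 1 ≤ w[i] ∧
      ∀ c, m < c → c < w[i] → ∃ j, ∃ hj : j < i, w[j] = c := by
  induction w generalizing m with
  | nil => simp [GrowsFrom]
  | cons x w ih =>
    rw [GrowsFrom, ih]
    constructor
    · rintro ⟨h1, h2, h3⟩ i hi
      cases i with
      | zero =>
        refine ⟨h1, fun c hc hcx => ?_⟩
        simp only [List.getElem_cons_zero] at hcx
        omega
      | succ i =>
        obtain ⟨h4, h5⟩ := h3 i (by simpa using hi)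
        refine ⟨by simpa using h4, fun c hc hcx => ?_⟩
        simp only [List.getElem_cons_succ] at hcx
        rcases le_or_gt c x with hle | hgt
        · exact ⟨0, by omega, by simp only [List.getElem_cons_zero]; omega⟩
        · obtain ⟨j, hj, hjc⟩ := h5 c (by omega) hcx
          exact ⟨j + 1, by omega, by simpa using hjc⟩
    · intro h
      have h0 := h 0 (by simp)
      simp only [List.getElem_cons_zero] at h0
      refine ⟨h0.1, ?_, fun i hi => ?_⟩
      · by_contra hlt
        obtain ⟨j, hj, -⟩ := h0.2 (m + 1) (by omega) (by omega)
        omega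
      · obtain ⟨h4, h5⟩ := h (i + 1) (by simpa using hi)
        refine ⟨by simpa using h4, fun c hc hcx => ?_⟩
        obtain ⟨j, hj, hjc⟩ := h5 c (by omega) (by simpa using hcx)
        cases j with
        | zero =>
          simp only [List.getElem_cons_zero] at hjc
          omega
        | succ j => exact ⟨j, by omega, by simpa using hjc⟩

theorem growsFrom_ofFn {n : ℕ} (σ : Fin n → ℕ) :
    GrowsFrom 0 (List.ofFn σ) ↔ RestrictedGrowth σ := by
  rw [growsFrom_iff]
  constructor
  · intro h i
    obtain ⟨h1, h2⟩ := h i (by simp)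
    refine ⟨by simpa using h1, fun c hc hci => ?_⟩
    obtain ⟨j, hj, hjc⟩ := h2 c (by omega) (by simpa using hci)
    exact ⟨⟨j, by omega⟩, hj, by simpa using hjc⟩
  · intro h i hi
    have hi' : i < n := by simpa using hi
    obtain ⟨h1, h2⟩ := h ⟨i, hi'⟩
    refine ⟨by simpa using h1, fun c hc hci => ?_⟩
    obtain ⟨j, hj, hjc⟩ := h2 c (by omega) (by simpa using hci)
    exact ⟨j, hj, by simpa using hjc⟩

/-- Avoiding partitions are counted by the restricted growth words that avoid the patterns, for
any description `Q` of pattern avoidance on words. -/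
theorem avoidCount_eq_ncard (T : Set (List ℕ)) (Q : List ℕ → Prop)
    (hQ : ∀ (n : ℕ) (σ : Fin n → ℕ), Q (List.ofFn σ) ↔ ∀ τ ∈ T, ¬ ContainsPattern σ τ) (n : ℕ) :
    avoidCount T n = {w : List ℕ | w.length = n ∧ GrowsFrom 0 w ∧ Q w}.ncard := by
  have himage : {w : List ℕ | w.length = n ∧ GrowsFrom 0 w ∧ Q w} =
      (fun P : Finpartition (Finset.univ : Finset (Fin n)) => List.ofFn (canonicalForm P)) ''
        avoiders T n := by
    ext w
    constructor
    · rintro ⟨rfl, hg, hq⟩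
      have hw : w = List.ofFn w.get := by simp
      rw [hw] at hg hq
      obtain ⟨P, hP⟩ := exists_canonicalForm_eq ((growsFrom_ofFn _).1 hg)
      refine ⟨P, ?_, ?_⟩
      · show ∀ τ ∈ T, ¬ ContainsPattern (canonicalForm P) τ
        rw [hP]
        exact (hQ _ _).1 hq
      · simp only [hP]
        exact hw.symm
    · rintro ⟨P, hP, rfl⟩
      exact ⟨by simp, (growsFrom_ofFn _).2 (restrictedGrowth_canonicalForm P), (hQ _ _).2 hP⟩
  rw [himage, avoidCount, Set.ncard_image_of_injective]
  exact List.ofFn_injective.comp canonicalForm_injective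

/-! ### Pattern containment in terms of sublists. -/

theorem containsPattern_iff_sublist {n : ℕ} (σ : Fin n → ℕ) (τ : List ℕ) :
    ContainsPattern σ τ ↔ ∃ v : List ℕ, ∃ hv : v.length = τ.length, v.Sublist (List.ofFn σ) ∧
      ∀ i j : Fin τ.length, (v[i] < v[j] ↔ τ.get i < τ.get j) ∧
        (v[i] > v[j] ↔ τ.get i > τ.get j) := by
  constructor
  · rintro ⟨f, hf, h⟩
    refine ⟨List.ofFn (σ ∘ f), by simp, ?_, by simpa using h⟩
    rw [List.sublist_iff_exists_fin_orderEmbedding_get_eq]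
    have hn : (List.ofFn σ).length = n := by simp
    have hm : (List.ofFn (σ ∘ f)).length = τ.length := by simp
    refine ⟨(Fin.castOrderIso hm).toOrderEmbedding.trans
      ((OrderEmbedding.ofStrictMono f hf).trans (Fin.castOrderIso hn.symm).toOrderEmbedding), ?_⟩
    intro i
    simp [Fin.cast]
  · rintro ⟨v, hv, hsub, h⟩
    rw [List.sublist_iff_exists_fin_orderEmbedding_get_eq] at hsub
    obtain ⟨f, hf⟩ := hsub
    have hn : (List.ofFn σ).length = n := by simp
    refine ⟨fun i => Fin.cast hn (f (Fin.cast hv.symm i)), ?_, ?_⟩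
    · intro i j hij
      have : f (Fin.cast hv.symm i) < f (Fin.cast hv.symm j) := f.strictMono hij
      exact this
    · intro i j
      have hval : ∀ i : Fin τ.length, σ (Fin.cast hn (f (Fin.cast hv.symm i))) = v[i] := by
        intro i
        have := hf (Fin.cast hv.symm i)
        simp only [List.get_ofFn] at this
        rw [← this]
        rfl
      rw [hval, hval]
      exact h i j

theorem containsPattern_length_four {n : ℕ} (σ : Fin n → ℕ) (p q r s : ℕ) :
    ContainsPattern σ [p, q, r, s] ↔ ∃ a b c d : ℕ, [a, b, c, d].Sublist (List.ofFn σ) ∧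
      ((a < b ↔ p < q) ∧ (b < a ↔ q < p)) ∧ ((a < c ↔ p < r) ∧ (c < a ↔ r < p)) ∧
      ((a < d ↔ p < s) ∧ (d < a ↔ s < p)) ∧ ((b < c ↔ q < r) ∧ (c < b ↔ r < q)) ∧
      ((b < d ↔ q < s) ∧ (d < b ↔ s < q)) ∧ ((c < d ↔ r < s) ∧ (d < c ↔ s < r)) := by
  rw [containsPattern_iff_sublist]
  constructor
  · rintro ⟨v, hv, hsub, h⟩
    match v, hv with
    | [a, b, c, d], hv =>
      refine ⟨a, b, c, d, hsub, ?_⟩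
      exact ⟨h 0 1, h 0 2, h 0 3, h 1 2, h 1 3, h 2 3⟩
  · rintro ⟨a, b, c, d, hsub, h01, h02, h03, h12, h13, h23⟩
    refine ⟨[a, b, c, d], rfl, hsub, ?_⟩
    intro i j
    simp only [List.length_cons, List.length_nil] at i j
    fin_cases i <;> fin_cases j <;>
      simp only [Fin.getElem_fin, List.get_eq_getElem] <;>
      simp only [List.getElem_cons_zero, List.getElem_cons_succ, gt_iff_lt, lt_self_iff_false,
        iff_self, and_self] <;> omega

theorem containsPattern_1123 {n : ℕ} (σ : Fin n → ℕ) : ContainsPattern σ [1, 1, 2, 3] ↔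
    ∃ a b c : ℕ, a < b ∧ b < c ∧ [a, a, b, c].Sublist (List.ofFn σ) := by
  rw [containsPattern_length_four]
  constructor
  · rintro ⟨a, b, c, d, hs, h⟩
    obtain rfl : a = b := by omega
    exact ⟨a, c, d, by omega, by omega, hs⟩
  · rintro ⟨a, b, c, hab, hbc, hs⟩
    exact ⟨a, a, b, c, hs, by omega⟩

theorem containsPattern_1222 {n : ℕ} (σ : Fin n → ℕ) : ContainsPattern σ [1, 2, 2, 2] ↔
    ∃ a b : ℕ, a < b ∧ [a, b, b, b].Sublist (List.ofFn σ) := by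
  rw [containsPattern_length_four]
  constructor
  · rintro ⟨a, b, c, d, hs, h⟩
    obtain rfl : b = c := by omega
    obtain rfl : b = d := by omega
    exact ⟨a, b, by omega, hs⟩
  · rintro ⟨a, b, hab, hs⟩
    exact ⟨a, b, b, b, hs, by omega⟩

theorem containsPattern_1211 {n : ℕ} (σ : Fin n → ℕ) : ContainsPattern σ [1, 2, 1, 1] ↔
    ∃ a b : ℕ, a < b ∧ [a, b, a, a].Sublist (List.ofFn σ) := by
  rw [containsPattern_length_four]
  constructor
  · rintro ⟨a, b, c, d, hs, h⟩
    obtain rfl : a = c := by omega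
    obtain rfl : a = d := by omega
    exact ⟨a, b, by omega, hs⟩
  · rintro ⟨a, b, hab, hs⟩
    exact ⟨a, b, a, a, hs, by omega⟩

/-! ### Words without increasing subsequences of length three -/

/-- Words with letters in `L ∪ U` in which letters outside `Z` occur at most once, which have no
increasing subsequence of length three, and whose letters in `U` decrease weakly. Such words arise
as the continuations of a word in which a letter between `L` and `U` has occurred. -/
structure Admissible (L U Z : Finset ℕ) (w : List ℕ) : Prop where
  mem : ∀ x ∈ w, x ∈ L ∨ x ∈ U
  once : ∀ x, x ∉ Z → ¬ [x, x].Sublist w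
  no_increasing : ∀ a b c, a < b → b < c → ¬ [a, b, c].Sublist w
  decreasing : ∀ a b, a ∈ U → b ∈ U → a < b → ¬ [a, b].Sublist w

theorem mem_of_pair_sublist {a b : ℕ} {w : List ℕ} (h : [a, b].Sublist w) : a ∈ w ∧ b ∈ w :=
  ⟨h.subset (by simp), h.subset (by simp)⟩

namespace Admissible

variable {L U Z : Finset ℕ} {x : ℕ} {w : List ℕ}

theorem nil : Admissible L U Z [] := by
  constructor <;> simp

/-- After an upper `x`, larger upper letters would ascend, and `x` itself is used up. All remaining
letters are then below `x`, so `x` starts no forbidden subsequence. -/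
theorem cons_upper (hLU : ∀ l ∈ L, ∀ u ∈ U, l < u) (hx : x ∈ U) (hZ : x ∉ Z) :
    Admissible L U Z (x :: w) ↔ Admissible L {y ∈ U | y < x} Z w := by
  constructor
  · rintro ⟨h1, h2, h3, h4⟩
    simp only [List.cons_sublist_cons', List.singleton_sublist, List.mem_cons] at *
    constructor
    · intro y hy
      have := h2 x hZ
      have := h4 x y hx
      have := h1 y (Or.inr hy)
      grind
    · grind
    · grind
    · grind
  · rintro ⟨h1, h2, h3, h4⟩
    constructor
    · grind
    · simp only [List.cons_sublist_cons', List.singleton_sublist]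
      grind
    · simp only [List.cons_sublist_cons']
      intro a b c hab hbc h
      rcases h with h | ⟨rfl, h⟩
      · exact h3 a b c hab hbc h
      · have := mem_of_pair_sublist h
        grind
    · simp only [List.cons_sublist_cons', List.singleton_sublist]
      intro a b ha hb hab h
      rcases h with h | ⟨rfl, h⟩
      · have := mem_of_pair_sublist h
        grind
      · grind

/-- As in `cons_upper`, but `x` stays available. -/
theorem cons_upper_of_mem (hLU : ∀ l ∈ L, ∀ u ∈ U, l < u) (hx : x ∈ U) (hZ : x ∈ Z) :
    Admissible L U Z (x :: w) ↔ Admissible L {y ∈ U | y ≤ x} Z w := by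
  constructor
  · rintro ⟨h1, h2, h3, h4⟩
    simp only [List.cons_sublist_cons', List.singleton_sublist, List.mem_cons] at *
    constructor
    · intro y hy
      have := h4 x y hx
      have := h1 y (Or.inr hy)
      grind
    · grind
    · grind
    · grind
  · rintro ⟨h1, h2, h3, h4⟩
    constructor
    · grind
    · simp only [List.cons_sublist_cons', List.singleton_sublist]
      grind
    · simp only [List.cons_sublist_cons']
      intro a b c hab hbc h
      rcases h with h | ⟨rfl, h⟩
      · exact h3 a b c hab hbc h
      · have := mem_of_pair_sublist h
        grind
    · simp only [List.cons_sublist_cons', List.singleton_sublist]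
      intro a b ha hb hab h
      rcases h with h | ⟨rfl, h⟩
      · have := mem_of_pair_sublist h
        grind
      · grind

/-- An ascent among letters above `x` would complete an increasing triple with `x`, so these letters
join the upper alphabet. -/
theorem cons_lower (hLU : ∀ l ∈ L, ∀ u ∈ U, l < u) (hx : x ∈ L) (hZ : x ∉ Z) :
    Admissible L U Z (x :: w) ↔ Admissible {y ∈ L | y < x} ({y ∈ L | x < y} ∪ U) Z w := by
  constructor
  · rintro ⟨h1, h2, h3, h4⟩
    simp only [List.cons_sublist_cons', List.singleton_sublist, List.mem_cons] at *
    constructor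
    · intro y hy
      have := h2 x hZ
      have := h1 y (Or.inr hy)
      grind
    · grind
    · grind
    · intro a b ha hb hab h
      have : x < a := by grind
      exact h3 x a b this hab (Or.inr ⟨rfl, h⟩)
  · rintro ⟨h1, h2, h3, h4⟩
    constructor
    · grind
    · simp only [List.cons_sublist_cons', List.singleton_sublist]
      grind
    · simp only [List.cons_sublist_cons']
      intro a b c hab hbc h
      rcases h with h | ⟨rfl, h⟩
      · exact h3 a b c hab hbc h
      · have := mem_of_pair_sublist h
        refine h4 b c ?_ ?_ hbc h <;> grind
    · simp only [List.cons_sublist_cons', List.singleton_sublist]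
      intro a b ha hb hab h
      rcases h with h | ⟨rfl, h⟩
      · have := mem_of_pair_sublist h
        grind
      · grind

/-- As in `cons_lower`, but `x` stays in the lower alphabet. -/
theorem cons_lower_of_mem (hLU : ∀ l ∈ L, ∀ u ∈ U, l < u) (hx : x ∈ L) (hZ : x ∈ Z) :
    Admissible L U Z (x :: w) ↔ Admissible {y ∈ L | y ≤ x} ({y ∈ L | x < y} ∪ U) Z w := by
  constructor
  · rintro ⟨h1, h2, h3, h4⟩
    simp only [List.cons_sublist_cons', List.singleton_sublist, List.mem_cons] at *
    constructor
    · intro y hy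
      have := h1 y (Or.inr hy)
      grind
    · grind
    · grind
    · intro a b ha hb hab h
      have : x < a := by grind
      exact h3 x a b this hab (Or.inr ⟨rfl, h⟩)
  · rintro ⟨h1, h2, h3, h4⟩
    constructor
    · grind
    · simp only [List.cons_sublist_cons', List.singleton_sublist]
      grind
    · simp only [List.cons_sublist_cons']
      intro a b c hab hbc h
      rcases h with h | ⟨rfl, h⟩
      · exact h3 a b c hab hbc h
      · have := mem_of_pair_sublist h
        refine h4 b c ?_ ?_ hbc h <;> grind
    · simp only [List.cons_sublist_cons', List.singleton_sublist]
      intro a b ha hb hab h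
      rcases h with h | ⟨rfl, h⟩
      · have := mem_of_pair_sublist h
        grind
      · grind

theorem congr_of_inter {Z' : Finset ℕ} (h : ∀ x, x ∈ L ∨ x ∈ U → (x ∈ Z ↔ x ∈ Z')) :
    Admissible L U Z w ↔ Admissible L U Z' w := by
  constructor
  · rintro ⟨h1, h2, h3, h4⟩
    refine ⟨h1, fun x hx hs => ?_, h3, h4⟩
    have := h1 x (mem_of_pair_sublist hs).1
    grind
  · rintro ⟨h1, h2, h3, h4⟩
    refine ⟨h1, fun x hx hs => ?_, h3, h4⟩
    have := h1 x (mem_of_pair_sublist hs).1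
    grind

/-- Used when a first letter turns a ban on a triple into a ban on `x x`: the letter `x` then
becomes an ordinary one-time letter. -/
theorem insert_iff : Admissible L U (insert x Z) w ∧ ¬ [x, x].Sublist w ↔
    Admissible L U (Z.erase x) w := by
  constructor
  · rintro ⟨⟨h1, h2, h3, h4⟩, h⟩
    refine ⟨h1, fun y hy hs => ?_, h3, h4⟩
    by_cases hyx : y = x
    · exact h (hyx ▸ hs)
    · exact h2 y (by grind) hs
  · rintro ⟨h1, h2, h3, h4⟩
    exact ⟨⟨h1, fun y hy => h2 y (by grind), h3, h4⟩, h2 x (by simp)⟩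

end Admissible

/-! ### Counting words by their first letter -/

/-- The number of words of length `n` with property `Q`. -/
noncomputable def wordCount (n : ℕ) (Q : List ℕ → Prop) : ℕ∞ := {w | w.length = n ∧ Q w}.encard

theorem wordCount_congr {n : ℕ} {Q R : List ℕ → Prop} (h : ∀ w, Q w ↔ R w) :
    wordCount n Q = wordCount n R := by
  rw [funext fun w => propext (h w)]

theorem wordCount_zero {Q : List ℕ → Prop} (h : Q []) : wordCount 0 Q = 1 := by
  have : {w : List ℕ | w.length = 0 ∧ Q w} = {[]} := by
    ext w
    simp only [List.length_eq_zero_iff, Set.mem_ofPred_eq, Set.mem_singleton_iff]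
    exact ⟨fun hw => hw.1, fun hw => ⟨hw, hw ▸ h⟩⟩
  rw [wordCount, this, Set.encard_singleton]

theorem wordCount_succ {Q : List ℕ → Prop} (A : Finset ℕ) (hA : ∀ x w, Q (x :: w) → x ∈ A)
    (n : ℕ) : wordCount (n + 1) Q = ∑ x ∈ A, wordCount n (fun w => Q (x :: w)) := by
  have hunion : {w : List ℕ | w.length = n + 1 ∧ Q w} =
      ⋃ x ∈ A, List.cons x '' {w | w.length = n ∧ Q (x :: w)} := by
    ext w
    simp only [Set.mem_ofPred_eq, Set.mem_iUnion, Set.mem_image]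
    constructor
    · rintro ⟨hl, hq⟩
      cases w with
      | nil => simp at hl
      | cons x w => exact ⟨x, hA x w hq, w, ⟨by simpa using hl, hq⟩, rfl⟩
    · rintro ⟨x, -, w, ⟨hl, hq⟩, rfl⟩
      exact ⟨by simp [hl], hq⟩
  rw [wordCount, hunion]
  clear hunion hA
  induction A using Finset.induction_on with
  | empty => simp
  | insert a A ha ih =>
    rw [Finset.set_biUnion_insert, Set.encard_union_eq, ih, Finset.sum_insert ha]
    · congr 1
      exact Function.Injective.encard_image List.cons_injective _
    · rw [Set.disjoint_left]
      rintro w ⟨v, -, rfl⟩ hw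
      simp only [Set.mem_iUnion, Set.mem_image] at hw
      obtain ⟨x, hx, u, -, hu⟩ := hw
      rw [List.cons.injEq] at hu
      exact ha (hu.1 ▸ hx)

/-- The number of smaller elements runs once through `0, …, s.card - 1`. This is why the counts
depend only on the sizes of the alphabets. -/
theorem sum_card_filter_lt {M : Type*} [AddCommMonoid M] (s : Finset ℕ) (g : ℕ → M) :
    ∑ x ∈ s, g {y ∈ s | y < x}.card = ∑ i ∈ Finset.range s.card, g i := by
  induction s using Finset.induction_on_max with
  | empty => simp
  | insert a s h ih =>
    have ha : a ∉ s := fun has => lt_irrefl _ (h a has)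
    rw [Finset.sum_insert ha, Finset.card_insert_of_notMem ha, Finset.sum_range_succ, add_comm,
      ← ih]
    congr 1
    · refine Finset.sum_congr rfl fun x hx => ?_
      congr 2
      ext y
      have := h x hx
      simp only [Finset.mem_filter, Finset.mem_insert]
      constructor
      · rintro ⟨rfl | hy, hyx⟩
        · omega
        · exact ⟨hy, hyx⟩
      · rintro ⟨hy, hyx⟩
        exact ⟨Or.inr hy, hyx⟩
    · congr 2
      ext y
      simp only [Finset.mem_filter, Finset.mem_insert]
      constructor
      · rintro ⟨rfl | hy, hyx⟩
        · omega
        · exact hy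
      · intro hy
        exact ⟨Or.inr hy, h y hy⟩

theorem card_filter_gt {s : Finset ℕ} {x : ℕ} (hx : x ∈ s) :
    {y ∈ s | x < y}.card = s.card - 1 - {y ∈ s | y < x}.card := by
  have h : s.erase x = {y ∈ s | y < x} ∪ {y ∈ s | x < y} := by
    ext y
    simp only [Finset.mem_erase, Finset.mem_union, Finset.mem_filter]
    rw [← and_or_left, and_comm, ne_iff_lt_or_gt]
  rw [← Finset.card_erase_of_mem hx, h, Finset.card_union_of_disjoint, Nat.add_sub_cancel_left]
  rw [Finset.disjoint_left]
  intro y hy hy'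
  simp only [Finset.mem_filter] at hy hy'
  omega

/-- A lower letter with `i` letters of `L` below it sends the other `L.card - 1 - i` to the upper
alphabet. -/
theorem sum_card_filter_lt_gt {M : Type*} [AddCommMonoid M] (L U : Finset ℕ)
    (hLU : ∀ l ∈ L, ∀ u ∈ U, l < u) (g : ℕ → ℕ → M) :
    ∑ x ∈ L, g {y ∈ L | y < x}.card ({y ∈ L | x < y} ∪ U).card =
      ∑ i ∈ Finset.range L.card, g i (U.card + L.card - 1 - i) := by
  rw [← sum_card_filter_lt L fun i => g i (U.card + L.card - 1 - i)]
  refine Finset.sum_congr rfl fun x hx => ?_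
  congr 1
  rw [Finset.card_union_of_disjoint, card_filter_gt hx]
  · have : {y ∈ L | y < x}.card < L.card := by
      apply Finset.card_lt_card
      refine ⟨Finset.filter_subset _ _, fun h => ?_⟩
      have := (Finset.mem_filter.1 (h hx)).2
      omega
    omega
  · rw [Finset.disjoint_left]
    intro y hy hyU
    exact lt_irrefl _ (hLU y (Finset.mem_filter.1 hy).1 y hyU)

/-! ### The numbers of admissible words

In all cases `j` and `k` are the numbers of letters in the lower and in the upper set that may occur
only once. -/

/-- The number of admissible words of length `n` in which every letter occurs at most once. -/
def simpleCount : ℕ → ℕ → ℕ → ℕ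
  | 0, _, _ => 1
  | n + 1, j, k => ∑ i ∈ Finset.range j, simpleCount n i (k + j - 1 - i) +
      ∑ i ∈ Finset.range k, simpleCount n j i

/-- The number of admissible words of length `n` in which the largest letter, an upper one, may
occur any number of times. -/
def topCount : ℕ → ℕ → ℕ → ℕ
  | 0, _, _ => 1
  | n + 1, j, k => topCount n j k + ∑ i ∈ Finset.range j, topCount n i (k + j - 1 - i) +
      ∑ i ∈ Finset.range k, simpleCount n j i

/-- The number of admissible words of length `n` in which the two largest letters `a < b`, both
upper ones, may occur any number of times, subject to the avoidance of `b a a`. -/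
def twoTopCount : ℕ → ℕ → ℕ → ℕ
  | 0, _, _ => 1
  | n + 1, j, k => topCount n j k + topCount n j (k + 1) +
      ∑ i ∈ Finset.range j, twoTopCount n i (k + j - 1 - i) +
      ∑ i ∈ Finset.range k, simpleCount n j i

/-- The number of admissible words of length `n` in which the largest lower letter `a` and a single
upper letter `b` may occur any number of times, subject to the avoidance of `b a a`. -/
def middleCount : ℕ → ℕ → ℕ
  | 0, _ => 1
  | n + 1, j => middleCount n j + topCount n (j + 1) 0 +
      ∑ i ∈ Finset.range j, twoTopCount n i (j - 1 - i)

/-- The number of admissible words of length `n` in which the smallest letter, a lower one, may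
occur any number of times. -/
def bottomCount : ℕ → ℕ → ℕ → ℕ
  | 0, _, _ => 1
  | n + 1, j, k => bottomCount n 0 (j + k) +
      ∑ i ∈ Finset.range j, bottomCount n i (k + j - 1 - i) +
      ∑ i ∈ Finset.range k, bottomCount n j i

/-- The number of admissible words of length `n` in which the smallest letter, a lower one, may
occur any number of times and the largest letter, an upper one, may occur twice. -/
def bottomTopCount : ℕ → ℕ → ℕ → ℕ
  | 0, _, _ => 1
  | n + 1, j, k => bottomTopCount n 0 (j + k) + bottomCount n j (k + 1) +
      ∑ i ∈ Finset.range j, bottomTopCount n i (k + j - 1 - i) +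
      ∑ i ∈ Finset.range k, bottomCount n j i

/-- The sum over the upper letters in a recursion by the first letter. -/
theorem sum_upper_eq (U : Finset ℕ) (F : ℕ → ℕ∞) (g : ℕ → ℕ)
    (h : ∀ x ∈ U, F x = g {y ∈ U | y < x}.card) :
    ∑ x ∈ U, F x = ((∑ i ∈ Finset.range U.card, g i : ℕ) : ℕ∞) := by
  rw [Finset.sum_congr rfl h, sum_card_filter_lt U fun i => (g i : ℕ∞), Nat.cast_sum]

/-- The sum over the lower letters in a recursion by the first letter. -/
theorem sum_lower_eq (L U : Finset ℕ) (hLU : ∀ l ∈ L, ∀ u ∈ U, l < u) (F : ℕ → ℕ∞)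
    (g : ℕ → ℕ → ℕ) (h : ∀ x ∈ L, F x = g {y ∈ L | y < x}.card ({y ∈ L | x < y} ∪ U).card) :
    ∑ x ∈ L, F x = ((∑ i ∈ Finset.range L.card, g i (U.card + L.card - 1 - i) : ℕ) : ℕ∞) := by
  rw [Finset.sum_congr rfl h, sum_card_filter_lt_gt L U hLU fun i k => (g i k : ℕ∞), Nat.cast_sum]

theorem disjoint_of_forall_lt {L U : Finset ℕ} (hLU : ∀ l ∈ L, ∀ u ∈ U, l < u) :
    Disjoint L U := by
  rw [Finset.disjoint_left]
  exact fun y hy hyU => lt_irrefl _ (hLU y hy y hyU)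

/-- One `b` being spent, only `b b` remains to be avoided, so `b` becomes a one-time letter. -/
theorem Admissible.cons_top_of_twice {L U : Finset ℕ} {a b : ℕ} {w : List ℕ}
    (hLU : ∀ l ∈ L, ∀ u ∈ U, l < u) (hb : b ∈ U) (hU : ∀ u ∈ U, u ≤ b) (hab : a < b) :
    Admissible L U {a, b} (b :: w) ∧ ¬ [b, b, b].Sublist (b :: w) ↔ Admissible L U {a} w := by
  rw [Admissible.cons_upper_of_mem hLU hb (by simp), Finset.filter_true_of_mem hU]
  have h2 : ({a} : Finset ℕ) = ({a, b} : Finset ℕ).erase b := by grind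
  have h3 : ({a, b} : Finset ℕ) = insert b {a, b} := by grind
  rw [h2, ← Admissible.insert_iff, ← h3, List.cons_sublist_cons']
  have : [b, b, b].Sublist w → [b, b].Sublist w := (List.sublist_cons_self _ _).trans
  grind

/-- Once `b` has occurred, avoiding `b a a` means that `a` occurs at most once more. -/
theorem Admissible.cons_top_of_avoids {L U : Finset ℕ} {a b : ℕ} {w : List ℕ}
    (hLU : ∀ l ∈ L, ∀ u ∈ U, l < u) (hb : b ∈ U) (hU : ∀ u ∈ U, u ≤ b) (hab : a < b) :
    Admissible L U {a, b} (b :: w) ∧ ¬ [b, a, a].Sublist (b :: w) ↔ Admissible L U {b} w := by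
  rw [Admissible.cons_upper_of_mem hLU hb (by simp), Finset.filter_true_of_mem hU]
  have h2 : ({b} : Finset ℕ) = ({a, b} : Finset ℕ).erase a := by grind
  have h3 : ({a, b} : Finset ℕ) = insert a {a, b} := by grind
  rw [h2, ← Admissible.insert_iff, ← h3, List.cons_sublist_cons']
  have : [b, a, a].Sublist w → [a, a].Sublist w := (List.sublist_cons_self _ _).trans
  grind

theorem wordCount_simple (n : ℕ) : ∀ (L U Z : Finset ℕ), (∀ l ∈ L, ∀ u ∈ U, l < u) →
    (∀ x, x ∈ L ∨ x ∈ U → x ∉ Z) →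
    wordCount n (Admissible L U Z) = simpleCount n L.card U.card := by
  induction n with
  | zero => intro L U Z _ _; rw [wordCount_zero Admissible.nil]; simp [simpleCount]
  | succ n ih =>
    intro L U Z hLU hZ
    rw [wordCount_succ (L ∪ U)
        (fun x w h => by simpa only [Finset.mem_union] using h.mem x (by simp)),
      Finset.sum_union (disjoint_of_forall_lt hLU), simpleCount, Nat.cast_add]
    congr 1
    · apply sum_lower_eq L U hLU _ (simpleCount n)
      intro x hx
      rw [wordCount_congr fun w => Admissible.cons_lower hLU hx (hZ x (Or.inl hx)), ih]
      · grind
      · grind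
    · apply sum_upper_eq U _ (simpleCount n L.card)
      intro x hx
      rw [wordCount_congr fun w => Admissible.cons_upper hLU hx (hZ x (Or.inr hx)), ih]
      · grind
      · grind

/-- Any first letter from `U` excludes the larger `b`, which leaves only one-time letters. -/
theorem wordCount_top (n : ℕ) : ∀ (L U : Finset ℕ) (b : ℕ), (∀ l ∈ L, ∀ u ∈ U, l < u) →
    (∀ x, x ∈ L ∨ x ∈ U → x < b) →
    wordCount n (Admissible L (insert b U) {b}) = topCount n L.card U.card := by
  induction n with
  | zero => intro L U b _ _; rw [wordCount_zero Admissible.nil]; simp [topCount]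
  | succ n ih =>
    intro L U b hLU hb
    have hLU' : ∀ l ∈ L, ∀ u ∈ insert b U, l < u := by grind
    have hbU : b ∉ U := fun h => lt_irrefl _ (hb b (Or.inr h))
    rw [wordCount_succ (L ∪ insert b U)
        (fun x w h => by simpa only [Finset.mem_union] using h.mem x (by simp)),
      Finset.sum_union (disjoint_of_forall_lt hLU'), Finset.sum_insert hbU, topCount, Nat.cast_add,
      Nat.cast_add, add_left_comm, add_assoc]
    congr 1
    · rw [wordCount_congr fun w => Admissible.cons_upper_of_mem hLU' (by simp) (by simp)]
      have : {y ∈ insert b U | y ≤ b} = insert b U := by grind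
      rw [this, ih L U b hLU hb]
    congr 1
    · apply sum_lower_eq L U hLU _ (topCount n)
      intro x hx
      rw [wordCount_congr fun w => Admissible.cons_lower hLU' hx (by grind), Finset.union_insert, ih]
      · grind
      · grind
    · apply sum_upper_eq U _ (simpleCount n L.card)
      intro x hx
      rw [wordCount_congr fun w => Admissible.cons_upper hLU' (by grind) (by grind)]
      have : {y ∈ insert b U | y < x} = {y ∈ U | y < x} := by grind
      rw [this, wordCount_simple]
      · grind
      · grind

/-- The first letter `a` sends all of `L` to the upper alphabet and remains alone below. Other first
letters never exclude `a`. -/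
theorem wordCount_bottom (n : ℕ) : ∀ (L U : Finset ℕ) (a : ℕ), (∀ l ∈ L, ∀ u ∈ U, l < u) →
    (∀ x, x ∈ L ∨ x ∈ U → a < x) →
    wordCount n (Admissible (insert a L) U {a}) = bottomCount n L.card U.card := by
  induction n with
  | zero => intro L U a _ _; rw [wordCount_zero Admissible.nil]; simp [bottomCount]
  | succ n ih =>
    intro L U a hLU ha
    have hLU' : ∀ l ∈ insert a L, ∀ u ∈ U, l < u := by grind
    have haL : a ∉ L := fun h => lt_irrefl _ (ha a (Or.inl h))
    rw [wordCount_succ (insert a L ∪ U)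
        (fun x w h => by simpa only [Finset.mem_union] using h.mem x (by simp)),
      Finset.sum_union (disjoint_of_forall_lt hLU'), Finset.sum_insert haL, bottomCount,
      Nat.cast_add, Nat.cast_add]
    congr 1
    · congr 1
      · rw [wordCount_congr fun w => Admissible.cons_lower_of_mem hLU' (by simp) (by simp)]
        have h1 : {y ∈ insert a L | y ≤ a} = insert a ∅ := by grind
        have h2 : {y ∈ insert a L | a < y} = L := by grind
        rw [h1, h2, ih ∅ (L ∪ U) a (by simp) (by grind),
          Finset.card_union_of_disjoint (disjoint_of_forall_lt hLU), Finset.card_empty]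
      · apply sum_lower_eq L U hLU _ (bottomCount n)
        intro x hx
        rw [wordCount_congr fun w => Admissible.cons_lower hLU' (by grind) (by grind)]
        have h1 : {y ∈ insert a L | y < x} = insert a {y ∈ L | y < x} := by grind
        have h2 : {y ∈ insert a L | x < y} = {y ∈ L | x < y} := by grind
        rw [h1, h2, ih]
        · grind
        · grind
    · apply sum_upper_eq U _ (bottomCount n L.card)
      intro x hx
      rw [wordCount_congr fun w => Admissible.cons_upper hLU' (by grind) (by grind), ih]
      · grind
      · grind

/-- The special top letter is lost in two ways: the first letter `b` makes it ordinary (hence `k +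
1`), and a first letter from `U` excludes it. -/
theorem wordCount_bottomTop (n : ℕ) : ∀ (L U : Finset ℕ) (a b : ℕ), (∀ l ∈ L, ∀ u ∈ U, l < u) →
    (∀ x, x ∈ L ∨ x ∈ U → a < x ∧ x < b) → a < b →
    wordCount n (fun w => Admissible (insert a L) (insert b U) {a, b} w ∧ ¬ [b, b, b].Sublist w) =
      bottomTopCount n L.card U.card := by
  induction n with
  | zero =>
    intro L U a b _ _ _
    rw [wordCount_zero ⟨Admissible.nil, by simp⟩]; simp [bottomTopCount]
  | succ n ih =>
    intro L U a b hLU h hab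
    have hLU' : ∀ l ∈ insert a L, ∀ u ∈ insert b U, l < u := by grind
    have haL : a ∉ L := by grind
    have hbU : b ∉ U := by grind
    have hsub : ∀ x w, x ≠ b → ([b, b, b].Sublist (x :: w) ↔ [b, b, b].Sublist w) := by
      intro x w hx
      rw [List.cons_sublist_cons']
      grind
    rw [wordCount_succ (insert a L ∪ insert b U)
        (fun x w h => by simpa only [Finset.mem_union] using h.1.mem x (by simp)),
      Finset.sum_union (disjoint_of_forall_lt hLU'), Finset.sum_insert haL, Finset.sum_insert hbU,
      bottomTopCount, Nat.cast_add, Nat.cast_add, Nat.cast_add, add_add_add_comm, ← add_assoc]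
    congr 1
    congr 1
    congr 1
    · rw [wordCount_congr fun w => and_congr
        (Admissible.cons_lower_of_mem hLU' (by simp) (by simp)) (not_congr (hsub a w (by omega)))]
      have h1 : {y ∈ insert a L | y ≤ a} = insert a ∅ := by grind
      have h2 : {y ∈ insert a L | a < y} = L := by grind
      rw [h1, h2, Finset.union_insert, ih ∅ (L ∪ U) a b (by simp) (by grind) hab,
        Finset.card_union_of_disjoint (disjoint_of_forall_lt hLU), Finset.card_empty]
    · rw [wordCount_congr fun w => Admissible.cons_top_of_twice hLU' (by simp) (by grind) hab,
        wordCount_bottom n L (insert b U) a (by grind) (by grind),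
        Finset.card_insert_of_notMem hbU]
    · apply sum_lower_eq L U hLU _ (bottomTopCount n)
      intro x hx
      rw [wordCount_congr fun w => and_congr
        (Admissible.cons_lower hLU' (by grind) (by grind)) (not_congr (hsub x w (by grind)))]
      have h1 : {y ∈ insert a L | y < x} = insert a {y ∈ L | y < x} := by grind
      have h2 : {y ∈ insert a L | x < y} = {y ∈ L | x < y} := by grind
      rw [h1, h2, Finset.union_insert, ih _ _ a b _ _ hab]
      · grind
      · grind
    · apply sum_upper_eq U _ (bottomCount n L.card)
      intro x hx
      have key : ∀ w, Admissible (insert a L) (insert b U) {a, b} (x :: w) ∧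
          ¬ [b, b, b].Sublist (x :: w) ↔ Admissible (insert a L) {y ∈ U | y < x} {a} w := by
        intro w
        rw [Admissible.cons_upper hLU' (by grind) (by grind), hsub x w (by grind)]
        have h1 : {y ∈ insert b U | y < x} = {y ∈ U | y < x} := by grind
        rw [h1, Admissible.congr_of_inter (Z' := {a}) (by grind)]
        refine ⟨fun h => h.1, fun h' => ⟨h', fun hs => ?_⟩⟩
        have := h'.mem b (hs.subset (by simp))
        grind
      rw [wordCount_congr key, wordCount_bottom]
      · grind
      · grind

/-- The first letter `a` excludes `b`, so `a` becomes an unrestricted top letter. The first letter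
`b` makes `a` an ordinary upper letter. A letter from `U` excludes both. -/
theorem wordCount_twoTop (n : ℕ) : ∀ (L U : Finset ℕ) (a b : ℕ), (∀ l ∈ L, ∀ u ∈ U, l < u) →
    (∀ x, x ∈ L ∨ x ∈ U → x < a) → a < b →
    wordCount n (fun w => Admissible L (insert a (insert b U)) {a, b} w ∧ ¬ [b, a, a].Sublist w) =
      twoTopCount n L.card U.card := by
  induction n with
  | zero =>
    intro L U a b _ _ _
    rw [wordCount_zero ⟨Admissible.nil, by simp⟩]; simp [twoTopCount]
  | succ n ih =>
    intro L U a b hLU h hab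
    have hLU' : ∀ l ∈ L, ∀ u ∈ insert a (insert b U), l < u := by grind
    have haU : a ∉ insert b U := by grind
    have hbU : b ∉ U := by grind
    have hsub : ∀ x w, x ≠ b → ([b, a, a].Sublist (x :: w) ↔ [b, a, a].Sublist w) := by
      intro x w hx
      rw [List.cons_sublist_cons']
      grind
    have hnot : ∀ (V Z : Finset ℕ) w, b ∉ L → b ∉ V → Admissible L V Z w → ¬ [b, a, a].Sublist w := by
      intro V Z w hbL hbV hw hs
      have := hw.mem b (hs.subset (by simp))
      grind
    have ha : wordCount n (fun w => Admissible L (insert a (insert b U)) {a, b} (a :: w) ∧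
        ¬ [b, a, a].Sublist (a :: w)) = topCount n L.card U.card := by
      have key : ∀ w, Admissible L (insert a (insert b U)) {a, b} (a :: w) ∧
          ¬ [b, a, a].Sublist (a :: w) ↔ Admissible L (insert a U) {a} w := by
        intro w
        rw [Admissible.cons_upper_of_mem hLU' (by simp) (by simp), hsub a w (by omega)]
        have h1 : {y ∈ insert a (insert b U) | y ≤ a} = insert a U := by grind
        rw [h1, Admissible.congr_of_inter (Z' := {a}) (by grind)]
        exact and_iff_left_of_imp (hnot _ _ w (by grind) (by grind))
      rw [wordCount_congr key, wordCount_top n L U a hLU (by grind)]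
    have hb : wordCount n (fun w => Admissible L (insert a (insert b U)) {a, b} (b :: w) ∧
        ¬ [b, a, a].Sublist (b :: w)) = topCount n L.card (U.card + 1) := by
      rw [wordCount_congr fun w => Admissible.cons_top_of_avoids hLU' (by simp) (by grind) hab,
        Finset.insert_comm, wordCount_top n L (insert a U) b (by grind) (by grind),
        Finset.card_insert_of_notMem (by grind)]
    have hL : ∑ x ∈ L, wordCount n (fun w => Admissible L (insert a (insert b U)) {a, b} (x :: w) ∧
        ¬ [b, a, a].Sublist (x :: w)) =
        ((∑ i ∈ Finset.range L.card, twoTopCount n i (U.card + L.card - 1 - i) : ℕ) : ℕ∞) := by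
      apply sum_lower_eq L U hLU _ (twoTopCount n)
      intro x hx
      rw [wordCount_congr fun w => and_congr
        (Admissible.cons_lower hLU' hx (by grind)) (not_congr (hsub x w (by grind))),
        Finset.union_insert, Finset.union_insert, ih _ _ a b _ _ hab]
      · grind
      · grind
    have hU : ∑ x ∈ U, wordCount n (fun w => Admissible L (insert a (insert b U)) {a, b} (x :: w) ∧
        ¬ [b, a, a].Sublist (x :: w)) =
        ((∑ i ∈ Finset.range U.card, simpleCount n L.card i : ℕ) : ℕ∞) := by
      apply sum_upper_eq U _ (simpleCount n L.card)
      intro x hx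
      have key : ∀ w, Admissible L (insert a (insert b U)) {a, b} (x :: w) ∧
          ¬ [b, a, a].Sublist (x :: w) ↔ Admissible L {y ∈ U | y < x} {a, b} w := by
        intro w
        rw [Admissible.cons_upper hLU' (by grind) (by grind), hsub x w (by grind)]
        have h1 : {y ∈ insert a (insert b U) | y < x} = {y ∈ U | y < x} := by
          clear ih ha hb hL hsub hnot
          grind
        rw [h1]
        exact and_iff_left_of_imp (hnot _ _ w (by grind) (by grind))
      rw [wordCount_congr key, wordCount_simple]
      · grind
      · grind
    rw [wordCount_succ (L ∪ insert a (insert b U))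
        (fun x w h => by simpa only [Finset.mem_union] using h.1.mem x (by simp)),
      Finset.sum_union (disjoint_of_forall_lt hLU'), Finset.sum_insert haU, Finset.sum_insert hbU,
      ha, hb, hL, hU, twoTopCount]
    push_cast
    ring

/-- The first letter `a` changes nothing, `b` makes `a` an ordinary lower letter, and any letter of
`L` moves `a` to the upper alphabet beside `b`. -/
theorem wordCount_middle (n : ℕ) : ∀ (L : Finset ℕ) (a b : ℕ), (∀ x ∈ L, x < a) → a < b →
    wordCount n (fun w => Admissible (insert a L) {b} {a, b} w ∧ ¬ [b, a, a].Sublist w) =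
      middleCount n L.card := by
  induction n with
  | zero =>
    intro L a b _ _
    rw [wordCount_zero ⟨Admissible.nil, by simp⟩]; simp [middleCount]
  | succ n ih =>
    intro L a b h hab
    have hLU' : ∀ l ∈ insert a L, ∀ u ∈ ({b} : Finset ℕ), l < u := by grind
    have haL : a ∉ L := by grind
    have hsub : ∀ x w, x ≠ b → ([b, a, a].Sublist (x :: w) ↔ [b, a, a].Sublist w) := by
      intro x w hx
      rw [List.cons_sublist_cons']
      grind
    have hb : wordCount n (fun w => Admissible (insert a L) {b} {a, b} (b :: w) ∧
        ¬ [b, a, a].Sublist (b :: w)) = topCount n (L.card + 1) 0 := by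
      rw [wordCount_congr fun w => Admissible.cons_top_of_avoids hLU' (by simp) (by simp) hab,
        show wordCount n (fun w => Admissible (insert a L) {b} {b} w) = _ from
          wordCount_top n (insert a L) ∅ b (by simp) (by grind),
        Finset.card_insert_of_notMem haL, Finset.card_empty]
    have ha : wordCount n (fun w => Admissible (insert a L) {b} {a, b} (a :: w) ∧
        ¬ [b, a, a].Sublist (a :: w)) = middleCount n L.card := by
      rw [← ih L a b h hab]
      apply wordCount_congr
      intro w
      have h1 : {y ∈ insert a L | y ≤ a} = insert a L := by grind
      have h2 : {y ∈ insert a L | a < y} ∪ {b} = {b} := by grind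
      rw [Admissible.cons_lower_of_mem hLU' (by simp) (by simp), hsub a w (by omega), h1, h2]
    have hL : ∑ x ∈ L, wordCount n (fun w => Admissible (insert a L) {b} {a, b} (x :: w) ∧
        ¬ [b, a, a].Sublist (x :: w)) =
        ((∑ i ∈ Finset.range L.card, twoTopCount n i (L.card - 1 - i) : ℕ) : ℕ∞) := by
      have := sum_lower_eq L ∅ (by simp) (fun x => wordCount n fun w =>
        Admissible (insert a L) {b} {a, b} (x :: w) ∧ ¬ [b, a, a].Sublist (x :: w)) (twoTopCount n)
      rw [this]
      · simp
      intro x hx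
      have h1 : {y ∈ insert a L | y < x} = {y ∈ L | y < x} := by
        clear ih ha hb this hsub
        grind
      have h2 : {y ∈ insert a L | x < y} ∪ {b} =
          insert a (insert b ({y ∈ L | x < y} ∪ ∅)) := by
        clear ih ha hb this hsub h1
        grind
      rw [wordCount_congr fun w => and_congr
        (Admissible.cons_lower hLU' (by grind) (by grind)) (not_congr (hsub x w (by grind))),
        h1, h2, wordCount_twoTop n _ _ a b _ _ hab]
      · grind
      · grind
    rw [wordCount_succ (insert a L ∪ {b})
        (fun x w h => by simpa only [Finset.mem_union] using h.1.mem x (by simp)),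
      Finset.sum_union (disjoint_of_forall_lt hLU'), Finset.sum_insert haL, Finset.sum_singleton,
      ha, hb, hL, middleCount]
    push_cast
    ring

/-! ### Restricted growth words with a given initial run -/

theorem GrowsFrom.pair_sublist {m y : ℕ} {w : List ℕ} (h : GrowsFrom m w) (hy : y ∈ w)
    (hmy : m + 1 < y) : [m + 1, y].Sublist w := by
  induction w with
  | nil => simp at hy
  | cons x w ih =>
    obtain ⟨h1, h2, h3⟩ := h
    have hyw : y ∈ w := by
      rcases List.mem_cons.1 hy with rfl | h
      · omega
      · exact h
    rw [List.cons_sublist_cons', List.singleton_sublist]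
    rcases h2.lt_or_eq with hlt | rfl
    · rw [max_eq_left (by omega)] at h3
      exact Or.inl (ih h3 hyw)
    · exact Or.inr ⟨rfl, hyw⟩

theorem growsFrom_of_forall_mem {m : ℕ} {w : List ℕ} (h : ∀ y ∈ w, 1 ≤ y ∧ y ≤ m + 1) :
    GrowsFrom m w := by
  induction w generalizing m with
  | nil => trivial
  | cons x w ih =>
    refine ⟨(h x (by simp)).1, (h x (by simp)).2, ih fun y hy => ?_⟩
    have := h y (by simp [hy])
    omega

theorem GrowsFrom.pos {m y : ℕ} {w : List ℕ} (h : GrowsFrom m w) (hy : y ∈ w) : 1 ≤ y := by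
  induction w generalizing m with
  | nil => simp at hy
  | cons x w ih =>
    rcases List.mem_cons.1 hy with rfl | h'
    · exact h.1
    · exact ih h.2.2 h'

theorem cons_sublist_range'_append {m a : ℕ} {s w : List ℕ} (ha : 1 ≤ a) (ham : a ≤ m)
    (hs : s.Sublist w) : (a :: s).Sublist (List.range' 1 m ++ w) := by
  have : [a].Sublist (List.range' 1 m) := by
    rw [List.singleton_sublist, List.mem_range'_1]
    omega
  exact this.append hs

/-- A subsequence of length four of `1 ⋯ m w` meets the initial run in an increasing word. -/
theorem sublist_range'_append_cases {m a b c d : ℕ} {w : List ℕ}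
    (h : [a, b, c, d].Sublist (List.range' 1 m ++ w)) :
    [a, b, c, d].Sublist w ∨ (1 ≤ a ∧ a ≤ m ∧ [b, c, d].Sublist w) ∨
      (1 ≤ a ∧ a < b ∧ b ≤ m ∧ [c, d].Sublist w) ∨ (a < b ∧ b < c ∧ c ≤ m) := by
  obtain ⟨l₁, l₂, h12, h1, h2⟩ := List.sublist_append_iff.1 h
  have hlt : l₁.Pairwise (· < ·) := (List.pairwise_lt_range' (s := 1)).sublist h1
  have hle : ∀ x ∈ l₁, 1 ≤ x ∧ x ≤ m := by
    intro x hx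
    have := List.mem_range'_1.1 (h1.subset hx)
    omega
  match l₁ with
  | [] => simp_all
  | [x] => simp_all
  | [x, y] => simp_all
  | x :: y :: z :: l =>
    simp only [List.cons_append, List.cons.injEq] at h12
    obtain ⟨rfl, rfl, rfl, -⟩ := h12
    simp only [List.pairwise_cons, List.mem_cons] at hlt
    exact Or.inr (Or.inr (Or.inr ⟨hlt.1 b (by simp), hlt.2.1 c (by simp), (hle c (by simp)).2⟩))

/-- Avoidance of `1123` and `1222`, for words. -/
def AvoidsTriple (w : List ℕ) : Prop :=
  (∀ a b c, a < b → b < c → ¬ [a, a, b, c].Sublist w) ∧ ∀ a b, a < b → ¬ [a, b, b, b].Sublist w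

/-- Avoidance of `1123` and `1211`, for words. -/
def AvoidsReturn (w : List ℕ) : Prop :=
  (∀ a b c, a < b → b < c → ¬ [a, a, b, c].Sublist w) ∧ ∀ a b, a < b → ¬ [a, b, a, a].Sublist w

/-- A letter above `m + 1` would be preceded by `m + 1`, giving `x x (m+1) y`. An increasing triple
in the suffix gains a second copy of its least letter from the run. Conversely, a 1123 takes at most
one letter from the run, so it leaves an increasing triple in the suffix. -/
theorem avoids_1123_range'_append {m x : ℕ} {w : List ℕ} (hx : 1 ≤ x) (hxm : x ≤ m) :
    (GrowsFrom m (x :: w) ∧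
      ∀ a b c, a < b → b < c → ¬ [a, a, b, c].Sublist (List.range' 1 m ++ x :: w)) ↔
    (∀ y ∈ x :: w, 1 ≤ y ∧ y ≤ m + 1) ∧
      ∀ a b c, a < b → b < c → ¬ [a, b, c].Sublist (x :: w) := by
  constructor
  · rintro ⟨hg, h⟩
    refine ⟨fun y hy => ⟨hg.pos hy, ?_⟩, fun a b c hab hbc hs => ?_⟩
    · by_contra hlt
      have hyw : y ∈ w := by
        rcases List.mem_cons.1 hy with rfl | h
        · omega
        · exact h
      have h3 := hg.2.2
      rw [max_eq_left hxm] at h3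
      refine h x (m + 1) y (by omega) (by omega) ?_
      exact cons_sublist_range'_append hx hxm ((h3.pair_sublist hyw (by omega)).cons_cons x)
    · have ha : 1 ≤ a := hg.pos (hs.subset (by simp))
      rcases le_or_gt a m with ham | ham
      · exact h a b c hab hbc (cons_sublist_range'_append ha ham hs)
      · have hs' : [a, b, c].Sublist w := by
          rw [List.cons_sublist_cons'] at hs
          rcases hs with hs | ⟨hax, -⟩
          · exact hs
          · omega
        -- Here `a` exceeds `m`, hence also `x`, so `x x a b` is the forbidden occurrence.
        refine h x a b (by omega) hab (cons_sublist_range'_append hx hxm ?_)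
        exact (List.Sublist.trans (by simp) hs').cons_cons x
  · rintro ⟨hmem, h⟩
    refine ⟨growsFrom_of_forall_mem hmem, fun a b c hab hbc hs => ?_⟩
    rcases sublist_range'_append_cases hs with hs | ⟨-, -, hs⟩ | hs | hs
    · exact h a b c hab hbc ((List.sublist_cons_self _ _).trans hs)
    · exact h a b c hab hbc hs
    · omega
    · omega

theorem admissible_Icc_iff {m : ℕ} {Z : Finset ℕ} {w : List ℕ} :
    Admissible (Finset.Icc 1 m) {m + 1} Z w ↔ ((∀ y ∈ w, 1 ≤ y ∧ y ≤ m + 1) ∧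
      ∀ a b c, a < b → b < c → ¬ [a, b, c].Sublist w) ∧ ∀ y, y ∉ Z → ¬ [y, y].Sublist w := by
  constructor
  · rintro ⟨h1, h2, h3, -⟩
    refine ⟨⟨fun y hy => ?_, h3⟩, h2⟩
    have := h1 y hy
    simp only [Finset.mem_Icc, Finset.mem_singleton] at this
    omega
  · rintro ⟨⟨h1, h3⟩, h2⟩
    refine ⟨fun y hy => ?_, h2, h3, fun a b ha hb hab => ?_⟩
    · have := h1 y hy
      simp only [Finset.mem_Icc, Finset.mem_singleton]
      omega
    · simp only [Finset.mem_singleton] at ha hb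
      omega

/-- For `2 ≤ y ≤ m` the run supplies `1 y`, so `y y` in the suffix completes 1222; for `y = m + 1`
it supplies only `1`, so three copies are needed. -/
theorem avoidsTriple_range'_append {m x : ℕ} {w : List ℕ} (hx : 1 ≤ x) (hxm : x ≤ m) :
    GrowsFrom m (x :: w) ∧ AvoidsTriple (List.range' 1 m ++ x :: w) ↔
      Admissible (Finset.Icc 1 m) {m + 1} {1, m + 1} (x :: w) ∧
        ¬ [m + 1, m + 1, m + 1].Sublist (x :: w) := by
  rw [AvoidsTriple, ← and_assoc, avoids_1123_range'_append hx hxm, admissible_Icc_iff, 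
    and_assoc (c := ¬ _)]
  refine and_congr_right ?_
  rintro ⟨hmem, -⟩
  constructor
  · intro h
    refine ⟨fun y hy hs => ?_, fun hs => ?_⟩
    · have := hmem y (mem_of_pair_sublist hs).1
      simp only [Finset.mem_insert, Finset.mem_singleton, not_or] at hy
      refine h 1 y (by omega) ?_
      have h1 : [1, y].Sublist (List.range' 1 m) := by
        obtain ⟨k, rfl⟩ : ∃ k, m = k + 1 := ⟨m - 1, by omega⟩
        rw [List.range'_succ, List.cons_sublist_cons, List.singleton_sublist, List.mem_range'_1]
        omega
      exact h1.append hs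
    · exact h 1 (m + 1) (by omega) (cons_sublist_range'_append le_rfl (by omega) hs)
  · rintro ⟨h1, h2⟩ a b hab hs
    have key : 1 ≤ a → ¬ [b, b, b].Sublist (x :: w) := by
      intro ha hs
      by_cases hbm : b = m + 1
      · exact h2 (hbm ▸ hs)
      · refine h1 b ?_ ((List.sublist_cons_self _ _).trans hs)
        simp only [Finset.mem_insert, Finset.mem_singleton]
        omega
    rcases sublist_range'_append_cases hs with hs | ⟨ha, -, hs⟩ | ⟨ha, -, hb, hs⟩ | hs
    · exact key (hmem a (hs.subset (by simp))).1 ((List.sublist_cons_self _ _).trans hs)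
    · exact key ha hs
    · refine h1 b ?_ hs
      simp only [Finset.mem_insert, Finset.mem_singleton]
      omega
    · omega

/-- For `y < m` the run supplies `y m`, so `y y` in the suffix completes 1211. For `m` the larger
letter can only be `m + 1`, which must come from the suffix. -/
theorem avoidsReturn_range'_append {m x : ℕ} {w : List ℕ} (hx : 1 ≤ x) (hxm : x ≤ m) :
    GrowsFrom m (x :: w) ∧ AvoidsReturn (List.range' 1 m ++ x :: w) ↔
      Admissible (Finset.Icc 1 m) {m + 1} {m, m + 1} (x :: w) ∧
        ¬ [m + 1, m, m].Sublist (x :: w) := by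
  rw [AvoidsReturn, ← and_assoc, avoids_1123_range'_append hx hxm, admissible_Icc_iff, 
    and_assoc (c := ¬ _)]
  refine and_congr_right ?_
  rintro ⟨hmem, -⟩
  constructor
  · intro h
    refine ⟨fun y hy hs => ?_, fun hs => ?_⟩
    · have := hmem y (mem_of_pair_sublist hs).1
      simp only [Finset.mem_insert, Finset.mem_singleton, not_or] at hy
      refine h y m (by omega) ?_
      have h1 : [y, m].Sublist (List.range' 1 m) := by
        obtain ⟨k, rfl⟩ : ∃ k, m = k + 1 := ⟨m - 1, by omega⟩
        rw [List.range'_1_concat, Nat.add_comm 1 k]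
        refine List.Sublist.append (l₁ := [y]) ?_ (List.Sublist.refl [k + 1])
        rw [List.singleton_sublist, List.mem_range'_1]
        omega
      exact h1.append hs
    · exact h m (m + 1) (by omega) (cons_sublist_range'_append (by omega) le_rfl hs)
  · rintro ⟨h1, h2⟩ a b hab hs
    have hsmall : a < m → ¬ [a, a].Sublist (x :: w) := by
      intro ha
      apply h1 a
      simp only [Finset.mem_insert, Finset.mem_singleton]
      omega
    have key : ¬ [b, a, a].Sublist (x :: w) := by
      intro hs
      have hb := hmem b (hs.subset (by simp))
      by_cases ham : a = m
      · obtain rfl : b = m + 1 := by omega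
        exact h2 (ham ▸ hs)
      · exact hsmall (by omega) ((List.sublist_cons_self _ _).trans hs)
    rcases sublist_range'_append_cases hs with hs | ⟨-, -, hs⟩ | ⟨-, -, hb, hs⟩ | hs
    · exact key ((List.sublist_cons_self _ _).trans hs)
    · exact key hs
    · exact hsmall (by omega) hs
    · omega

theorem avoids_range' (m : ℕ) (a b c d : ℕ) (h : b ≤ a ∨ c ≤ b ∨ d ≤ c) :
    ¬ [a, b, c, d].Sublist (List.range' 1 m) := by
  intro hs
  have := (List.pairwise_lt_range' (s := 1)).sublist hs
  simp only [List.pairwise_cons, List.mem_cons] at this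
  have h1 := this.1 b (by simp)
  have h2 := this.2.1 c (by simp)
  have h3 := this.2.2.1 d (by simp)
  omega

theorem avoidsTriple_range' (m : ℕ) : AvoidsTriple (List.range' 1 m) :=
  ⟨fun a b c _ _ => avoids_range' m a a b c (by omega),
    fun a b _ => avoids_range' m a b b b (by omega)⟩

theorem avoidsReturn_range' (m : ℕ) : AvoidsReturn (List.range' 1 m) :=
  ⟨fun a b c _ _ => avoids_range' m a a b c (by omega),
    fun a b _ => avoids_range' m a b a a (by omega)⟩

/-- If the avoiding words with initial run `1 ⋯ m` and next letter at most `m` are described by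
`R m`, and the words satisfying `R` are counted by `f` and `g`, then the avoiding words with a
given initial run satisfy a linear recursion. -/
theorem exists_prefixCount (T : Set (List ℕ)) (Q : List ℕ → Prop) (R : ℕ → List ℕ → Prop)
    (f g : ℕ → ℕ → ℕ)
    (hQ : ∀ (n : ℕ) (σ : Fin n → ℕ), Q (List.ofFn σ) ↔ ∀ τ ∈ T, ¬ ContainsPattern σ τ)
    (hnil : ∀ m, Q (List.range' 1 m))
    (hR : ∀ m x w, 1 ≤ x → x ≤ m →
      (GrowsFrom m (x :: w) ∧ Q (List.range' 1 m ++ x :: w) ↔ R m (x :: w)))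
    (hmem : ∀ m x w, R m (x :: w) → x ∈ Finset.Icc 1 (m + 1))
    (hf : ∀ m n, wordCount n (R (m + 1)) = f n m)
    (hg : ∀ m n, wordCount n (fun w => R (m + 1) ((m + 2) :: w)) = g n m) :
    ∃ P : ℕ → ℕ → ℕ, (∀ n, P 0 n = avoidCount T n) ∧ (∀ m, P m 0 = 1) ∧
      (∀ n, P 0 (n + 1) = P 1 n) ∧ ∀ m n, P (m + 1) (n + 1) + g n m = P (m + 2) n + f (n + 1) m := by
  set C : ℕ → ℕ → ℕ∞ := fun m n =>
    wordCount n (fun s => GrowsFrom m s ∧ Q (List.range' 1 m ++ s)) with hC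
  have hC0 : ∀ m, C m 0 = 1 := fun m => wordCount_zero ⟨trivial, by simpa using hnil m⟩
  have hCsucc : ∀ m n, C m (n + 1) = C (m + 1) n +
      ∑ x ∈ Finset.Icc 1 m, wordCount n (fun w => R m (x :: w)) := by
    intro m n
    rw [hC]
    simp only
    rw [wordCount_succ (Finset.Icc 1 (m + 1)), Finset.sum_Icc_succ_top (by omega), add_comm]
    · congr 1
      · apply wordCount_congr
        intro w
        rw [GrowsFrom, max_eq_right (by omega), List.range'_1_concat, List.append_assoc,
          List.singleton_append, Nat.add_comm 1 m]
        refine and_congr_left fun _ => ?_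
        constructor
        · exact fun h => h.2.2
        · exact fun h => ⟨by omega, le_rfl, h⟩
      · refine Finset.sum_congr rfl fun x hx => ?_
        rw [Finset.mem_Icc] at hx
        exact wordCount_congr fun w => hR m x w hx.1 hx.2
    · intro x w h
      rw [Finset.mem_Icc]
      exact ⟨h.1.1, h.1.2.1⟩
  -- `f` also counts suffixes starting with the new letter `m + 2`, which extend the run instead;
  -- `g` counts these and is added on the other side to avoid subtraction.
  have hRsum : ∀ m n, (∑ x ∈ Finset.Icc 1 (m + 1), wordCount n (fun w => R (m + 1) (x :: w))) +
      (g n m : ℕ∞) = f (n + 1) m := by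
    intro m n
    rw [← hf, wordCount_succ _ (hmem (m + 1)),
      Finset.sum_Icc_succ_top (b := m + 1) (by omega), hg]
  have hC1 : ∀ n, C 0 (n + 1) = C 1 n := by
    intro n
    rw [hCsucc]
    simp
  have hC2 : ∀ m n, C (m + 1) (n + 1) + g n m = C (m + 2) n + (f (n + 1) m : ℕ) := by
    intro m n
    rw [hCsucc, add_assoc, hRsum]
  -- Counts live in `ℕ∞`; finiteness follows from the recursion itself and permits the return to
  -- `ℕ`.
  have hfin : ∀ n m, C m n ≠ ⊤ := by
    intro n
    induction n with
    | zero => intro m; rw [hC0]; simp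
    | succ n ih =>
      intro m
      cases m with
      | zero => rw [hC1]; exact ih 1
      | succ m =>
        intro h
        have := hC2 m n
        rw [h, top_add] at this
        exact (WithTop.add_ne_top.2 ⟨ih (m + 2), ENat.natCast_ne_top _⟩) this.symm
  have hcoe : ∀ m n, ((C m n).toNat : ℕ∞) = C m n := fun m n => ENat.natCast_toNat (hfin n m)
  refine ⟨fun m n => (C m n).toNat, fun n => ?_, fun m => ?_, fun n => ?_, fun m n => ?_⟩
  · rw [avoidCount_eq_ncard T Q hQ]
    simp [hC, wordCount, Set.ncard]
  · simp [hC0]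
  · simp only [hC1]
  · have := hC2 m n
    rw [← hcoe (m + 1), ← hcoe (m + 2)] at this
    exact_mod_cast this

theorem exists_prefixCount_triple : ∃ P : ℕ → ℕ → ℕ,
    (∀ n, P 0 n = avoidCount {[1, 1, 2, 3], [1, 2, 2, 2]} n) ∧ (∀ m, P m 0 = 1) ∧
      (∀ n, P 0 (n + 1) = P 1 n) ∧
      ∀ m n, P (m + 1) (n + 1) + bottomCount n m 1 = P (m + 2) n + bottomTopCount (n + 1) m 0 := by
  refine exists_prefixCount _ AvoidsTriple (fun m w =>
      Admissible (Finset.Icc 1 m) {m + 1} {1, m + 1} w ∧ ¬ [m + 1, m + 1, m + 1].Sublist w)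
    (fun n m => bottomTopCount n m 0) (fun n m => bottomCount n m 1) ?_ avoidsTriple_range'
    (fun m x w hx hxm => avoidsTriple_range'_append hx hxm) ?_ ?_ ?_
  · intro n σ
    simp only [Set.mem_insert_iff, Set.mem_singleton_iff, forall_eq_or_imp, forall_eq,
      containsPattern_1123, containsPattern_1222, AvoidsTriple, not_exists, not_and]
  · intro m x w h
    have := h.1.mem x (by simp)
    simp only [Finset.mem_Icc, Finset.mem_singleton] at this ⊢
    omega
  all_goals
    intro m n
    have hI : Finset.Icc 1 (m + 1) = insert 1 (Finset.Icc 2 (m + 1)) := by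
      ext y
      simp only [Finset.mem_Icc, Finset.mem_insert]
      omega
    have hcard : (Finset.Icc 2 (m + 1)).card = m := by simp
  · have := wordCount_bottomTop n (Finset.Icc 2 (m + 1)) ∅ 1 (m + 2) (by simp)
      (fun x hx => by simp at hx; omega) (by omega)
    rw [hcard, ← hI] at this
    exact this
  · have := wordCount_bottom n (Finset.Icc 2 (m + 1)) {m + 2} 1
      (fun l hl u hu => by simp at hl hu; omega) (fun x hx => by simp at hx; omega)
    rw [hcard, ← hI, Finset.card_singleton] at this
    rw [← this]
    exact wordCount_congr fun w => Admissible.cons_top_of_twice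
      (fun l hl u hu => by simp at hl hu; omega) (by simp) (by simp) (by omega)

theorem exists_prefixCount_return : ∃ P : ℕ → ℕ → ℕ,
    (∀ n, P 0 n = avoidCount {[1, 1, 2, 3], [1, 2, 1, 1]} n) ∧ (∀ m, P m 0 = 1) ∧
      (∀ n, P 0 (n + 1) = P 1 n) ∧
      ∀ m n, P (m + 1) (n + 1) + topCount n (m + 1) 0 = P (m + 2) n + middleCount (n + 1) m := by
  refine exists_prefixCount _ AvoidsReturn (fun m w =>
      Admissible (Finset.Icc 1 m) {m + 1} {m, m + 1} w ∧ ¬ [m + 1, m, m].Sublist w)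
    (fun n m => middleCount n m) (fun n m => topCount n (m + 1) 0) ?_ avoidsReturn_range'
    (fun m x w hx hxm => avoidsReturn_range'_append hx hxm) ?_ ?_ ?_
  · intro n σ
    simp only [Set.mem_insert_iff, Set.mem_singleton_iff, forall_eq_or_imp, forall_eq,
      containsPattern_1123, containsPattern_1211, AvoidsReturn, not_exists, not_and]
  · intro m x w h
    have := h.1.mem x (by simp)
    simp only [Finset.mem_Icc, Finset.mem_singleton] at this ⊢
    omega
  · intro m n
    have hI : Finset.Icc 1 (m + 1) = insert (m + 1) (Finset.Icc 1 m) := by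
      ext y
      simp only [Finset.mem_Icc, Finset.mem_insert]
      omega
    have := wordCount_middle n (Finset.Icc 1 m) (m + 1) (m + 2)
      (fun x hx => by simp at hx; omega) (by omega)
    rw [← hI, Nat.card_Icc, Nat.add_sub_cancel] at this
    exact this
  · intro m n
    have := wordCount_top n (Finset.Icc 1 (m + 1)) ∅ (m + 2) (by simp)
      (fun x hx => by simp at hx; omega)
    rw [Nat.card_Icc, Nat.add_sub_cancel] at this
    rw [← Finset.card_empty (α := ℕ), ← this]
    exact wordCount_congr fun w => Admissible.cons_top_of_avoids
      (fun l hl u hu => by simp at hl hu; omega) (by simp) (by simp) (by omega)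

/-! ### Generating functions -/

open PowerSeries in
/-- The sum `∑ j, X ^ j * a j`. -/
noncomputable def shiftedSum : (ℕ → PowerSeries ℚ) →ₗ[PowerSeries ℚ] PowerSeries ℚ where
  -- The term `X ^ j * a j` has no coefficients below degree `j`, so the truncation at `N` loses
  -- nothing.
  toFun a := PowerSeries.mk fun N => ∑ j ∈ Finset.range (N + 1), coeff N (X ^ j * a j)
  map_add' a b := by
    ext N
    simp [Finset.sum_add_distrib, mul_add]
  map_smul' c a := by
    ext N
    have hext : ∀ q ≤ N, ∑ j ∈ Finset.range (q + 1), coeff q (X ^ j * a j) =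
        ∑ j ∈ Finset.range (N + 1), coeff q (X ^ j * a j) := by
      intro q hq
      refine Finset.sum_subset (by simpa using hq) fun j _ hj => ?_
      rw [coeff_X_pow_mul', if_neg (by simpa using hj)]
    simp only [Pi.smul_apply, smul_eq_mul, coeff_mk, RingHom.id_apply]
    rw [coeff_mul]
    simp only [coeff_mk]
    have hinner : ∀ p ∈ Finset.HasAntidiagonal.antidiagonal N,
        coeff p.1 c * ∑ j ∈ Finset.range (p.2 + 1), coeff p.2 (X ^ j * a j) =
          ∑ j ∈ Finset.range (N + 1), coeff p.1 c * coeff p.2 (X ^ j * a j) := by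
      intro p hp
      rw [hext p.2 (by rw [Finset.HasAntidiagonal.mem_antidiagonal] at hp; omega), Finset.mul_sum]
    rw [Finset.sum_congr rfl hinner, Finset.sum_comm]
    refine Finset.sum_congr rfl fun j _ => ?_
    rw [mul_left_comm, coeff_mul]

open PowerSeries in
theorem shiftedSum_eq (a : ℕ → PowerSeries ℚ) :
    shiftedSum a = a 0 + X * shiftedSum fun j => a (j + 1) := by
  ext N
  cases N with
  | zero => simp [shiftedSum]
  | succ N =>
    rw [map_add, coeff_succ_X_mul]
    simp only [shiftedSum, LinearMap.coe_mk, AddHom.coe_mk, coeff_mk]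
    rw [Finset.sum_range_succ', add_comm]
    simp only [pow_zero, one_mul, pow_succ', mul_assoc, coeff_succ_X_mul]

/-! ### `X`-adic uniqueness of solutions. -/

section Uniqueness

open PowerSeries

theorem eq_zero_of_forall_X_pow_dvd {ι : Type*} (h : ι → PowerSeries ℚ)
    (hstep : ∀ n, (∀ i, X ^ n ∣ h i) → ∀ i, X ^ (n + 1) ∣ h i) (i : ι) : h i = 0 := by
  have hall : ∀ n, ∀ i, X ^ n ∣ h i := by
    intro n
    induction n with
    | zero => simp
    | succ n ih => exact hstep n ih
  ext n
  exact X_pow_dvd_iff.1 (hall (n + 1) i) n (Nat.lt_succ_self n)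

theorem X_pow_succ_dvd_X_mul {n : ℕ} {f : PowerSeries ℚ} (h : X ^ n ∣ f) : X ^ (n + 1) ∣ X * f := by
  rw [pow_succ']
  exact mul_dvd_mul_left X h

theorem eq_shiftedSum_of_eq (A a : ℕ → PowerSeries ℚ) (h : ∀ m, A m = a m + X * A (m + 1)) (m : ℕ) :
    A m = shiftedSum fun j => a (m + j) := by
  rw [← sub_eq_zero]
  refine eq_zero_of_forall_X_pow_dvd (fun m => A m - shiftedSum fun j => a (m + j)) ?_ m
  intro n ih m
  have : (A m - shiftedSum fun j => a (m + j)) =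
      X * (A (m + 1) - shiftedSum fun j => a (m + 1 + j)) := by
    rw [h, shiftedSum_eq]
    have : (fun j => a (m + (j + 1))) = fun j => a (m + 1 + j) := by
      funext j
      congr 1
      omega
    rw [this, add_zero]
    ring
  rw [this]
  exact X_pow_succ_dvd_X_mul (ih (m + 1))

/-- The kernel equation with a sum over the smaller indices has a unique solution. -/
theorem kernel_unique {H V c H' V' : ℕ → PowerSeries ℚ}
    (hH : ∀ k, H k = c k + X * (V k + ∑ i ∈ Finset.range k, H i))
    (hV : ∀ k, V k = X * (H k + V (k + 1)))
    (hH' : ∀ k, H' k = c k + X * (V' k + ∑ i ∈ Finset.range k, H' i))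
    (hV' : ∀ k, V' k = X * (H' k + V' (k + 1))) (k : ℕ) : H k = H' k ∧ V k = V' k := by
  -- The differences for `H` and `V` form one family indexed by `Bool × ℕ`; each is `X` times a
  -- combination of members of the family.
  have key := eq_zero_of_forall_X_pow_dvd
    (fun p : Bool × ℕ => if p.1 then H p.2 - H' p.2 else V p.2 - V' p.2) ?_
  · exact ⟨sub_eq_zero.1 (key (true, k)), sub_eq_zero.1 (key (false, k))⟩
  · intro n ih
    have ih1 : ∀ k, X ^ n ∣ H k - H' k := fun k => ih (true, k)
    have ih2 : ∀ k, X ^ n ∣ V k - V' k := fun k => ih (false, k)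
    rintro ⟨_ | _, k⟩
    · show X ^ (n + 1) ∣ V k - V' k
      have : V k - V' k = X * ((H k - H' k) + (V (k + 1) - V' (k + 1))) := by
        rw [hV, hV']; ring
      rw [this]
      exact X_pow_succ_dvd_X_mul (dvd_add (ih1 _) (ih2 _))
    · show X ^ (n + 1) ∣ H k - H' k
      have : H k - H' k = X * ((V k - V' k) + ∑ i ∈ Finset.range k, (H i - H' i)) := by
        rw [hH, hH', Finset.sum_sub_distrib]; ring
      rw [this]
      exact X_pow_succ_dvd_X_mul (dvd_add (ih2 _) (Finset.dvd_sum fun i _ => ih1 i))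

/-- The kernel equation without a sum over the smaller indices has a unique solution. -/
theorem kernel_unique_of_local {H V c H' V' : ℕ → PowerSeries ℚ} (r : PowerSeries ℚ)
    (hH : ∀ k, H k = c k + X * (r * H k + V k))
    (hV : ∀ k, V k = X * (H k + V (k + 1)))
    (hH' : ∀ k, H' k = c k + X * (r * H' k + V' k))
    (hV' : ∀ k, V' k = X * (H' k + V' (k + 1))) (k : ℕ) : H k = H' k ∧ V k = V' k := by
  have key := eq_zero_of_forall_X_pow_dvd
    (fun p : Bool × ℕ => if p.1 then H p.2 - H' p.2 else V p.2 - V' p.2) ?_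
  · exact ⟨sub_eq_zero.1 (key (true, k)), sub_eq_zero.1 (key (false, k))⟩
  · intro n ih
    have ih1 : ∀ k, X ^ n ∣ H k - H' k := fun k => ih (true, k)
    have ih2 : ∀ k, X ^ n ∣ V k - V' k := fun k => ih (false, k)
    rintro ⟨_ | _, k⟩
    · show X ^ (n + 1) ∣ V k - V' k
      have : V k - V' k = X * ((H k - H' k) + (V (k + 1) - V' (k + 1))) := by
        rw [hV, hV']; ring
      rw [this]
      exact X_pow_succ_dvd_X_mul (dvd_add (ih1 _) (ih2 _))
    · show X ^ (n + 1) ∣ H k - H' k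
      have : H k - H' k = X * (r * (H k - H' k) + (V k - V' k)) := by
        linear_combination hH k - hH' k
      rw [this]
      exact X_pow_succ_dvd_X_mul (dvd_add (dvd_mul_of_dvd_right (ih1 k) r) (ih2 _))

end Uniqueness

/-! ### From counting recursions to equations between power series. -/

section Kernel

open PowerSeries

/-- The sum over the lower letters in the recursions by the first letter. -/
noncomputable def lowerSum (F : ℕ → ℕ → PowerSeries ℚ) (j k : ℕ) : PowerSeries ℚ :=
  ∑ i ∈ Finset.range j, F i (k + j - 1 - i)

/-- Splitting off the last term gives `lowerSum F (j + 1) k = F j k + lowerSum F j (k + 1)`, and the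
shift in `j` costs exactly one factor `X`. -/
theorem shiftedSum_lowerSum (F : ℕ → ℕ → PowerSeries ℚ) (k : ℕ) :
    (shiftedSum fun j => lowerSum F j k) =
      X * ((shiftedSum fun j => F j k) + shiftedSum fun j => lowerSum F j (k + 1)) := by
  rw [shiftedSum_eq, ← map_add]
  have h0 : lowerSum F 0 k = 0 := by simp [lowerSum]
  rw [h0, zero_add]
  congr 2
  funext j
  rw [Pi.add_apply, lowerSum, Finset.sum_range_succ, add_comm, lowerSum]
  congr 1
  · congr 1
    omega
  · refine Finset.sum_congr rfl fun i _ => ?_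
    congr 1
    omega

/-- The generating function of a sequence of natural numbers. -/
noncomputable def natSeries (f : ℕ → ℕ) : PowerSeries ℚ := PowerSeries.mk fun n => (f n : ℚ)

theorem natSeries_eq {f g : ℕ → ℕ} (h0 : f 0 = 1) (h : ∀ n, f (n + 1) = g n) :
    natSeries f = 1 + X * natSeries g := by
  ext n
  cases n with
  | zero => simp [natSeries, h0]
  | succ n =>
    rw [map_add, coeff_succ_X_mul]
    simp [natSeries, h, coeff_one]

theorem natSeries_add (f g : ℕ → ℕ) :
    (natSeries fun n => f n + g n) = natSeries f + natSeries g := by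
  ext n
  simp [natSeries]

theorem natSeries_sum (s : Finset ℕ) (f : ℕ → ℕ → ℕ) :
    (natSeries fun n => ∑ i ∈ s, f n i) = ∑ i ∈ s, natSeries fun n => f n i := by
  ext n
  simp [natSeries]

/-- The generating function of `simpleCount`. -/
noncomputable def simpleSeries (j k : ℕ) : PowerSeries ℚ := natSeries fun n => simpleCount n j k

/-- The generating function of `topCount`. -/
noncomputable def topSeries (j k : ℕ) : PowerSeries ℚ := natSeries fun n => topCount n j k

/-- The generating function of `twoTopCount`. -/
noncomputable def twoTopSeries (j k : ℕ) : PowerSeries ℚ := natSeries fun n => twoTopCount n j k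

/-- The generating function of `middleCount`. -/
noncomputable def middleSeries (j : ℕ) : PowerSeries ℚ := natSeries fun n => middleCount n j

/-- The generating function of `bottomCount`. -/
noncomputable def bottomSeries (j k : ℕ) : PowerSeries ℚ := natSeries fun n => bottomCount n j k

/-- The generating function of `bottomTopCount`. -/
noncomputable def bottomTopSeries (j k : ℕ) : PowerSeries ℚ :=
  natSeries fun n => bottomTopCount n j k

theorem simpleSeries_eq (j k : ℕ) : simpleSeries j k =
    1 + X * (lowerSum simpleSeries j k + ∑ i ∈ Finset.range k, simpleSeries j i) := by
  simp only [simpleSeries, lowerSum, ← natSeries_add, ← natSeries_sum]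
  exact natSeries_eq rfl fun n => rfl

theorem topSeries_eq (j k : ℕ) : topSeries j k = 1 + X * (topSeries j k +
    lowerSum topSeries j k + ∑ i ∈ Finset.range k, simpleSeries j i) := by
  simp only [topSeries, simpleSeries, lowerSum, ← natSeries_add, ← natSeries_sum]
  exact natSeries_eq rfl fun n => rfl

theorem twoTopSeries_eq (j k : ℕ) : twoTopSeries j k = 1 + X * (topSeries j k +
    topSeries j (k + 1) + lowerSum twoTopSeries j k + ∑ i ∈ Finset.range k, simpleSeries j i) := by
  simp only [twoTopSeries, topSeries, simpleSeries, lowerSum, ← natSeries_add, ← natSeries_sum]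
  exact natSeries_eq rfl fun n => rfl

theorem middleSeries_eq (j : ℕ) : middleSeries j = 1 + X * (middleSeries j +
    topSeries (j + 1) 0 + lowerSum twoTopSeries j 0) := by
  simp only [twoTopSeries, topSeries, middleSeries, lowerSum, ← natSeries_add, ← natSeries_sum,
    zero_add]
  exact natSeries_eq rfl fun n => rfl

theorem bottomSeries_eq (j k : ℕ) : bottomSeries j k = 1 + X * (bottomSeries 0 (j + k) +
    lowerSum bottomSeries j k + ∑ i ∈ Finset.range k, bottomSeries j i) := by
  simp only [bottomSeries, lowerSum, ← natSeries_add, ← natSeries_sum]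
  exact natSeries_eq rfl fun n => rfl

theorem bottomTopSeries_eq (j k : ℕ) : bottomTopSeries j k = 1 + X * (bottomTopSeries 0 (j + k) +
    bottomSeries j (k + 1) + lowerSum bottomTopSeries j k +
    ∑ i ∈ Finset.range k, bottomSeries j i) := by
  simp only [bottomTopSeries, bottomSeries, lowerSum, ← natSeries_add, ← natSeries_sum]
  exact natSeries_eq rfl fun n => rfl

/-- The generating function of avoiding partitions, from the recursion on the initial run. -/
theorem avoidGenFun_eq (T : Set (List ℕ)) (P f g : ℕ → ℕ → ℕ) (h : ∀ n, P 0 n = avoidCount T n)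
    (h0 : ∀ m, P m 0 = 1) (h1 : ∀ n, P 0 (n + 1) = P 1 n) (hf : ∀ m, f 0 m = 1)
    (h2 : ∀ m n, P (m + 1) (n + 1) + g n m = P (m + 2) n + f (n + 1) m) :
    avoidGenFun T = 1 + X * ((shiftedSum fun m => natSeries fun n => f n m) -
      X * shiftedSum fun m => natSeries fun n => g n m) := by
  have hT : avoidGenFun T = natSeries (P 0) := by
    ext n
    simp [avoidGenFun, natSeries, h]
  rw [hT, natSeries_eq (h0 0) h1, eq_shiftedSum_of_eq (fun m => natSeries (P (m + 1)))
    (fun m => (natSeries fun n => f n m) - X * natSeries fun n => g n m) _ 0]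
  · simp only [zero_add]
    rw [← smul_eq_mul X (shiftedSum fun m => natSeries fun n => g n m), ← map_smul, ← map_sub]
    rfl
  · intro m
    ext n
    cases n with
    | zero => simp [natSeries, h0, hf]
    | succ n =>
      rw [map_add, map_sub, coeff_succ_X_mul, coeff_succ_X_mul]
      have := h2 m n
      have : (P (m + 1) (n + 1) : ℚ) + g n m = P (m + 2) n + f (n + 1) m := by exact_mod_cast this
      simp only [natSeries, coeff_mk]
      linarith

end Kernel

/-! ### Closed forms in terms of the Catalan-type series `v`. -/

section ClosedForms

open PowerSeries

theorem shiftedSum_one {r : PowerSeries ℚ} (hr : r * (1 - X) = 1) : (shiftedSum fun _ => 1) = r := by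
  have h := shiftedSum_eq fun _ => 1
  linear_combination r * h - (shiftedSum fun _ => 1) * hr

theorem shiftedSum_pow {r : PowerSeries ℚ} (hr : r * (1 - X) = 1) :
    (1 - 2 * X) * (shiftedSum fun j => r ^ j) = 1 - X := by
  have h := shiftedSum_eq fun j => r ^ j
  have h2 : (shiftedSum fun j => r ^ (j + 1)) = r * shiftedSum fun j => r ^ j := by
    rw [← smul_eq_mul, ← map_smul]
    congr 1
    funext j
    exact pow_succ' r j
  rw [h2, pow_zero] at h
  linear_combination (1 - X) * h + X * (shiftedSum fun j => r ^ j) * hr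

theorem shiftedSum_mul_left (c : PowerSeries ℚ) (a : ℕ → PowerSeries ℚ) :
    (shiftedSum fun j => c * a j) = c * shiftedSum a := map_smul shiftedSum c a

theorem shiftedSum_add (a b : ℕ → PowerSeries ℚ) :
    (shiftedSum fun j => a j + b j) = shiftedSum a + shiftedSum b := map_add shiftedSum a b

theorem shiftedSum_sum (s : Finset ℕ) (a : ℕ → ℕ → PowerSeries ℚ) :
    (shiftedSum fun j => ∑ i ∈ s, a i j) = ∑ i ∈ s, shiftedSum (a i) := by
  rw [← map_sum]
  congr 1
  funext j
  rw [Finset.sum_apply]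

theorem X_mul_sum_pow (r v : PowerSeries ℚ) (k : ℕ) :
    X * (∑ i ∈ Finset.range k, r * v * (1 + X * v) ^ i) =
    r * ((1 + X * v) ^ k - 1) := by
  rw [← mul_geom_sum, ← Finset.mul_sum]
  ring

/-- Seeking a solution geometric in `k`, with ratio `1 + X * v`, the constant terms force the factor
`r * v`, and the remaining equations reduce to the quadratic equation for `v`. -/
theorem shiftedSum_simpleSeries {r v : PowerSeries ℚ} (hr : r * (1 - X) = 1)
    (hv : v = 1 + X ^ 2 * r * v ^ 2) (k : ℕ) :
    (shiftedSum fun j => simpleSeries j k) = r * v * (1 + X * v) ^ k := by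
  refine (kernel_unique (V := fun k => shiftedSum fun j => lowerSum simpleSeries j k)
    (V' := fun k => X * v * r * (r * v * (1 + X * v) ^ k)) (c := fun _ => r)
    (H := fun k => shiftedSum fun j => simpleSeries j k)
    (H' := fun k => r * v * (1 + X * v) ^ k) ?_ ?_ ?_ ?_ k).1
  · intro k
    rw [funext fun j => simpleSeries_eq j k, shiftedSum_add, shiftedSum_mul_left, shiftedSum_add,
      shiftedSum_sum, shiftedSum_one hr]
  · exact shiftedSum_lowerSum _
  · intro k
    rw [mul_add, X_mul_sum_pow r v]
    linear_combination r * (1 + X * v) ^ k * hv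
  · intro k
    rw [pow_succ]
    grind

/-- The sums of `simpleSeries` are known, so the equation is local in `k`, with solution `r * v * (1
+ X * v) ^ k / (1 - X * v)`. Since `(1 - X * v) * (1 - 2 * X - X ^ 2 * v) = 1 - 3 * X + X ^ 2`,
rationalizing introduces `d`. -/
theorem shiftedSum_topSeries {r v d : PowerSeries ℚ} (hr : r * (1 - X) = 1)
    (hv : v = 1 + X ^ 2 * r * v ^ 2)
    (hd : d * (1 - 3 * X + X ^ 2) = 1) (k : ℕ) : (shiftedSum fun j => topSeries j k) =
      r * v * d * (1 - 2 * X - X ^ 2 * v) * (1 + X * v) ^ k := by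
  refine (kernel_unique_of_local 1 (V := fun k => shiftedSum fun j => lowerSum topSeries j k)
    (V' := fun k => X * v * r * (r * v * d * (1 - 2 * X - X ^ 2 * v) * (1 + X * v) ^ k))
    (c := fun k => r * (1 + X * v) ^ k) (H := fun k => shiftedSum fun j => topSeries j k)
    (H' := fun k => r * v * d * (1 - 2 * X - X ^ 2 * v) * (1 + X * v) ^ k) ?_ ?_ ?_ ?_ k).1
  · intro k
    have h := congrArg shiftedSum (funext fun j => topSeries_eq j k)
    rw [shiftedSum_add, shiftedSum_mul_left, shiftedSum_add, shiftedSum_add, shiftedSum_sum,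
      shiftedSum_one hr, Finset.sum_congr rfl fun i _ => shiftedSum_simpleSeries hr hv i] at h
    linear_combination h + X_mul_sum_pow r v k
  · exact shiftedSum_lowerSum _
  · intro k
    grind
  · intro k
    rw [pow_succ]
    grind

theorem shiftedSum_lowerSum_twoTopSeries {r v d : PowerSeries ℚ} (hr : r * (1 - X) = 1)
    (hv : v = 1 + X ^ 2 * r * v ^ 2)
    (hd : d * (1 - 3 * X + X ^ 2) = 1) :
    (shiftedSum fun j => lowerSum twoTopSeries j 0) = X * v * r * (v * (r + X * (r * v * d *
      (1 - 2 * X - X ^ 2 * v)) * (2 + X * v))) := by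
  have := (kernel_unique_of_local 0 (V := fun k => shiftedSum fun j => lowerSum twoTopSeries j k)
    (V' := fun k => X * v * r * (v * (r + X * (r * v * d * (1 - 2 * X - X ^ 2 * v)) * (2 + X * v)) *
      (1 + X * v) ^ k))
    (c := fun k => (r + X * (r * v * d * (1 - 2 * X - X ^ 2 * v)) * (2 + X * v)) * (1 + X * v) ^ k)
    (H := fun k => shiftedSum fun j => twoTopSeries j k)
    (H' := fun k => v * (r + X * (r * v * d * (1 - 2 * X - X ^ 2 * v)) * (2 + X * v)) *
      (1 + X * v) ^ k) ?_ ?_ ?_ ?_ 0).2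
  · simpa using this
  · intro k
    rw [funext fun j => twoTopSeries_eq j k, shiftedSum_add, shiftedSum_mul_left, shiftedSum_add,
      shiftedSum_add, shiftedSum_add, shiftedSum_sum, shiftedSum_one hr,
      Finset.sum_congr rfl fun i _ => shiftedSum_simpleSeries hr hv i,
      shiftedSum_topSeries hr hv hd, shiftedSum_topSeries hr hv hd]
    linear_combination X_mul_sum_pow r v k
  · exact shiftedSum_lowerSum _
  · intro k
    generalize r + X * (r * v * d * (1 - 2 * X - X ^ 2 * v)) * (2 + X * v) = c
    linear_combination c * (1 + X * v) ^ k * hv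
  · intro k
    rw [pow_succ]
    generalize r + X * (r * v * d * (1 - 2 * X - X ^ 2 * v)) * (2 + X * v) = c
    grind

theorem topSeries_zero_zero : (1 - X) * topSeries 0 0 = 1 := by
  have := topSeries_eq 0 0
  simp only [lowerSum, Finset.range_zero, Finset.sum_empty, add_zero] at this
  linear_combination this

/-- Such words are a decreasing choice of upper letters with copies of the bottom letter in every
gap, and `1 + X * r = r`. -/
theorem bottomSeries_zero {r : PowerSeries ℚ} (hr : r * (1 - X) = 1) (k : ℕ) :
    bottomSeries 0 k = r ^ (k + 1) := by
  induction k using Nat.strong_induction_on with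
  | _ k ih =>
    have := bottomSeries_eq 0 k
    rw [Finset.sum_congr rfl fun i hi => ih i (Finset.mem_range.1 hi)] at this
    simp only [lowerSum, Finset.range_zero, Finset.sum_empty, add_zero, zero_add, pow_succ,
      ← Finset.sum_mul] at this
    have hg := mul_geom_sum r k
    rw [pow_succ]
    set g := ∑ i ∈ Finset.range k, r ^ i
    generalize r ^ k = m at *
    generalize bottomSeries 0 k = b at *
    grind

/-- The recursion differs from that of `bottomSeries 0 k` only by the words starting with the top
letter. -/
theorem bottomTopSeries_zero {r : PowerSeries ℚ} (hr : r * (1 - X) = 1) (k : ℕ) :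
    bottomTopSeries 0 k = r ^ (k + 1) + X * r ^ (k + 3) := by
  have h1 := bottomTopSeries_eq 0 k
  have h2 := bottomSeries_eq 0 k
  rw [bottomSeries_zero hr (k + 1)] at h1
  rw [zero_add, bottomSeries_zero hr k] at h2
  simp only [lowerSum, Finset.range_zero, Finset.sum_empty, add_zero, zero_add, pow_succ] at *
  set g := ∑ i ∈ Finset.range k, bottomSeries 0 i
  generalize r ^ k = m at *
  generalize bottomTopSeries 0 k = b at *
  grind

/-- Words starting with the bottom letter contribute an inhomogeneous term in `r ^ k`; hence two
geometric sequences appear. -/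
theorem shiftedSum_bottomSeries {r v d : PowerSeries ℚ} (hr : r * (1 - X) = 1)
    (hv : v = 1 + X ^ 2 * r * v ^ 2) (hd : d * (1 - 3 * X + X ^ 2) = 1) (k : ℕ) :
    (shiftedSum fun j => bottomSeries j k) = d * r ^ k - X * r * v * d * (1 + X * v) ^ k := by
  set g := shiftedSum fun j => r ^ j with hg
  have hq : (1 - 2 * X) * g = 1 - X := shiftedSum_pow hr
  -- `hrd` and `hdg` balance the constant terms and the coefficients of `r ^ k` in the equation for
  -- `H'`; `hgr` and `hvr` serve the one for `V'`.
  have hrd : r + X * r * d = d * (1 - X) := by grind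
  have hdg : d = g * (r + X * d) := by grind
  have hgr : g = 1 + X * r * g := by grind
  have hvr : v * r = 1 + X * (v * r) * (1 + X * v) := by grind
  refine (kernel_unique (V := fun k => shiftedSum fun j => lowerSum bottomSeries j k)
    (V' := fun k => X * (g * (d * r ^ k) - r * v * (X * r * v * d * (1 + X * v) ^ k)))
    (c := fun k => r + X * (r ^ (k + 1) * g))
    (H := fun k => shiftedSum fun j => bottomSeries j k)
    (H' := fun k => d * r ^ k - X * r * v * d * (1 + X * v) ^ k) ?_ ?_ ?_ ?_ k).1
  · intro k
    have h := congrArg shiftedSum (funext fun j => bottomSeries_eq j k)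
    have h0 : (fun j => bottomSeries 0 (j + k)) = fun j => r ^ (k + 1) * r ^ j := by
      funext j
      rw [bottomSeries_zero hr, ← pow_add]
      congr 1
      omega
    rw [shiftedSum_add, shiftedSum_mul_left, shiftedSum_add, shiftedSum_add, shiftedSum_sum,
      shiftedSum_one hr, h0, shiftedSum_mul_left, ← hg] at h
    linear_combination h
  · exact shiftedSum_lowerSum _
  · intro k
    rw [Finset.sum_sub_distrib, ← Finset.mul_sum, ← Finset.mul_sum]
    have h1 := mul_geom_sum r k
    have h2 := mul_geom_sum (1 + X * v) k
    rw [pow_succ]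
    have hs₁ : X * ∑ i ∈ Finset.range k, r ^ i = (1 - X) * (r ^ k - 1) := by
      linear_combination (1 - X) * h1 - (∑ i ∈ Finset.range k, r ^ i) * hr
    linear_combination X * r ^ k * hdg - hrd + X * r * d * (1 + X * v) ^ k * (-hv) -
      d * hs₁ + X * r * d * h2
  · intro k
    rw [pow_succ, pow_succ]
    generalize r ^ k = m₁ at *
    generalize (1 + X * v) ^ k = m₂ at *
    linear_combination X * d * m₁ * hgr - X ^ 2 * r * v * d * m₂ * hvr

theorem shiftedSum_bottomTopSeries {r v d : PowerSeries ℚ} (hr : r * (1 - X) = 1)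
    (hv : v = 1 + X ^ 2 * r * v ^ 2) (hd : d * (1 - 3 * X + X ^ 2) = 1) (k : ℕ) :
    (shiftedSum fun j => bottomTopSeries j k) = (1 - X + X ^ 2) * r ^ 2 * d * r ^ k -
      v * X * r * d * (1 + X * v * (1 + X * v)) * (1 + X * v) ^ k := by
  set g := shiftedSum fun j => r ^ j with hg
  have hq : (1 - 2 * X) * g = 1 - X := shiftedSum_pow hr
  have hrd : r + X * r * d = d * (1 - X) := by grind
  have hgr : g = 1 + X * r * g := by grind
  have hvr : v * r = 1 + X * (v * r) * (1 + X * v) := by grind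
  -- The balance of the coefficients of `r ^ k` in the equation for `H'`.
  have hβ : (1 - X + X ^ 2) * r ^ 2 * d = X * r * g + X ^ 2 * r ^ 3 * g + X * d * r + d * (1 - X) +
      X ^ 2 * g * ((1 - X + X ^ 2) * r ^ 2 * d) := by grind
  refine (kernel_unique_of_local 0 (V := fun k => shiftedSum fun j => lowerSum bottomTopSeries j k)
    (V' := fun k => X * (g * ((1 - X + X ^ 2) * r ^ 2 * d * r ^ k) -
      r * v * (v * X * r * d * (1 + X * v * (1 + X * v)) * (1 + X * v) ^ k)))
    (c := fun k => X * r ^ (k + 1) * g + X ^ 2 * r ^ (k + 3) * g +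
      X * (d * r ^ (k + 1) - X * r * v * d * (1 + X * v) ^ (k + 1)) + d * (1 - X) * r ^ k -
      X * r * d * (1 + X * v) ^ k)
    (H := fun k => shiftedSum fun j => bottomTopSeries j k)
    (H' := fun k => (1 - X + X ^ 2) * r ^ 2 * d * r ^ k -
      v * X * r * d * (1 + X * v * (1 + X * v)) * (1 + X * v) ^ k) ?_ ?_ ?_ ?_ k).1
  · intro k
    have h := congrArg shiftedSum (funext fun j => bottomTopSeries_eq j k)
    have h0 : (fun j => bottomTopSeries 0 (j + k)) =
        fun j => (r ^ (k + 1) + X * r ^ (k + 3)) * r ^ j := by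
      funext j
      rw [bottomTopSeries_zero hr]
      ring
    rw [shiftedSum_add, shiftedSum_mul_left, shiftedSum_add, shiftedSum_add, shiftedSum_add,
      shiftedSum_sum, shiftedSum_one hr, h0, shiftedSum_mul_left, ← hg,
      shiftedSum_bottomSeries hr hv hd,
      Finset.sum_congr rfl fun i _ => shiftedSum_bottomSeries hr hv hd i,
      Finset.sum_sub_distrib, ← Finset.mul_sum, ← Finset.mul_sum] at h
    have h1 := mul_geom_sum r k
    have h2 := mul_geom_sum (1 + X * v) k
    have hs₁ : X * ∑ i ∈ Finset.range k, r ^ i = (1 - X) * (r ^ k - 1) := by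
      linear_combination (1 - X) * h1 - (∑ i ∈ Finset.range k, r ^ i) * hr
    linear_combination h + hrd + d * hs₁ - X * r * d * h2
  · exact shiftedSum_lowerSum _
  · intro k
    linear_combination r ^ k * hβ -
      X * r * d * (1 + X * v * (1 + X * v)) * (1 + X * v) ^ k * hv
  · intro k
    linear_combination X * ((1 - X + X ^ 2) * r ^ 2 * d) * r ^ k * hgr -
      X * (v * X * r * d * (1 + X * v * (1 + X * v))) * (1 + X * v) ^ k * hvr

theorem shiftedSum_middleSeries {r v d : PowerSeries ℚ} (hr : r * (1 - X) = 1)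
    (hv : v = 1 + X ^ 2 * r * v ^ 2) (hd : d * (1 - 3 * X + X ^ 2) = 1) :
    (1 - X) * shiftedSum middleSeries = r * v * d * (1 - 2 * X - X ^ 2 * v) +
      X ^ 2 * v * r * (v * (r + X * (r * v * d * (1 - 2 * X - X ^ 2 * v)) * (2 + X * v))) := by
  have h := congrArg shiftedSum (funext middleSeries_eq)
  have h0 := shiftedSum_eq fun j => topSeries j 0
  have h1 : topSeries 0 0 = r := by
    linear_combination r * topSeries_zero_zero - topSeries 0 0 * hr
  rw [shiftedSum_add, shiftedSum_mul_left, shiftedSum_add, shiftedSum_add, shiftedSum_one hr,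
    shiftedSum_lowerSum_twoTopSeries hr hv hd] at h
  rw [shiftedSum_topSeries hr hv hd, h1] at h0
  linear_combination h - h0

theorem avoidGenFun_triple {r v d : PowerSeries ℚ} (hr : r * (1 - X) = 1)
    (hv : v = 1 + X ^ 2 * r * v ^ 2) (hd : d * (1 - 3 * X + X ^ 2) = 1) :
    2 * X ^ 2 * (1 - X) ^ 2 * (1 - 3 * X + X ^ 2) * avoidGenFun {[1, 1, 2, 3], [1, 2, 2, 2]} =
      (1 - X) ^ 2 * (1 - X ^ 2) * (1 - X - 2 * X ^ 2 * v) -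
        (1 - 3 * X - 2 * X ^ 2 + 14 * X ^ 3 - 15 * X ^ 4 + 3 * X ^ 5) := by
  obtain ⟨P, h, h0, h1, h2⟩ := exists_prefixCount_triple
  rw [avoidGenFun_eq _ P (fun n m => bottomTopCount n m 0) (fun n m => bottomCount n m 1) h h0 h1
    (fun m => rfl) h2]
  have h3 := shiftedSum_bottomTopSeries hr hv hd 0
  have h4 := shiftedSum_bottomSeries hr hv hd 1
  rw [pow_zero, pow_zero, mul_one, mul_one] at h3
  rw [pow_one, pow_one] at h4
  simp only [bottomTopSeries, bottomSeries] at h3 h4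
  rw [h3, h4]
  clear h3 h4 h h0 h1 h2
  grind

theorem avoidGenFun_return {r v d : PowerSeries ℚ} (hr : r * (1 - X) = 1)
    (hv : v = 1 + X ^ 2 * r * v ^ 2) (hd : d * (1 - 3 * X + X ^ 2) = 1) :
    2 * X ^ 2 * (1 - X) ^ 2 * (1 - 3 * X + X ^ 2) * avoidGenFun {[1, 1, 2, 3], [1, 2, 1, 1]} =
      (1 - X) ^ 2 * (1 - X ^ 2) * (1 - X - 2 * X ^ 2 * v) -
        (1 - 3 * X - 2 * X ^ 2 + 14 * X ^ 3 - 15 * X ^ 4 + 3 * X ^ 5) := by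
  obtain ⟨P, h, h0, h1, h2⟩ := exists_prefixCount_return
  rw [avoidGenFun_eq _ P (fun n m => middleCount n m) (fun n m => topCount n (m + 1) 0) h h0 h1
    (fun m => rfl) h2]
  have h3 := shiftedSum_middleSeries hr hv hd
  have h4 := shiftedSum_eq fun j => topSeries j 0
  have h5 : topSeries 0 0 = r := by
    linear_combination r * topSeries_zero_zero - topSeries 0 0 * hr
  rw [shiftedSum_topSeries hr hv hd, h5, pow_zero, mul_one] at h4
  have h6 : shiftedSum middleSeries = shiftedSum fun m => natSeries fun n => middleCount n m := rfl
  have h7 : (shiftedSum fun j => topSeries (j + 1) 0) =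
    shiftedSum fun m => natSeries fun n => topCount n (m + 1) 0 := rfl
  rw [← h6, ← h7]
  generalize shiftedSum middleSeries = p at *
  generalize (shiftedSum fun j => topSeries (j + 1) 0) = y at *
  clear h6 h7 h h0 h1 h2 h5
  -- With `r` and `d` cleared, the claim becomes polynomial in `X`, `v`, `p` and `y`; `hy` and `hp`
  -- eliminate `y` and `p`, and `hv'` is the only relation left for `v`.
  have hv' : (1 - X) * (v - 1) = X ^ 2 * v ^ 2 := by
    linear_combination (1 - X) * hv + X ^ 2 * v ^ 2 * hr
  have hy : (1 - X) * (1 - 3 * X + X ^ 2) * (X * y) =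
      v * (1 - 2 * X - X ^ 2 * v) - (1 - 3 * X + X ^ 2) := by
    linear_combination (-(1 - X) * (1 - 3 * X + X ^ 2)) * h4 +
      (v * d * (1 - 2 * X - X ^ 2 * v) * (1 - 3 * X + X ^ 2) - (1 - 3 * X + X ^ 2)) * hr +
      v * (1 - 2 * X - X ^ 2 * v) * hd
  have hp : (1 - X) ^ 2 * (1 - 3 * X + X ^ 2) * p = v * (1 - 2 * X - X ^ 2 * v) +
      (v - 1) * (1 - 3 * X + X ^ 2 + X * v * (1 - 2 * X - X ^ 2 * v) * (2 + X * v)) := by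
    have hb : (1 - 3 * X + X ^ 2) * (d * (1 - 2 * X - X ^ 2 * v)) = 1 - 2 * X - X ^ 2 * v := by
      linear_combination (1 - 2 * X - X ^ 2 * v) * hd
    generalize hbdef : d * (1 - 2 * X - X ^ 2 * v) = b at hb
    have h3' : (1 - X) * p = r * (v * b + X ^ 2 * v ^ 2 * (r * (1 + X * v * b * (2 + X * v)))) := by
      rw [h3, ← hbdef]
      ring
    have hq : (1 - X) ^ 2 * p = v * b + (v - 1) * (1 + X * v * b * (2 + X * v)) := by
      linear_combination (1 - X) * h3' +
        (v * b + X ^ 2 * v ^ 2 * (r * (1 + X * v * b * (2 + X * v)))) * hr -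
        (1 + X * v * b * (2 + X * v)) * hv
    linear_combination (1 - 3 * X + X ^ 2) * hq + (v + (v - 1) * X * v * (2 + X * v)) * hb
  linear_combination 2 * X ^ 3 * hp - 2 * X ^ 3 * (1 - X) * hy +
    (2 * X ^ 5 * v ^ 2 + 6 * X ^ 4 * v - 2 * X ^ 5 * v + 2 * X ^ 2 - 2 * X ^ 4) * hv'

/-- The Catalan series at `X ^ 2 / (1 - X)`. -/
theorem exists_catalan_kernel (r : PowerSeries ℚ) :
    ∃ v : PowerSeries ℚ, v = 1 + X ^ 2 * r * v ^ 2 := by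
  have ha : HasSubst (X ^ 2 * r : PowerSeries ℚ) :=
    HasSubst.of_constantCoeff_zero' (by simp)
  have hc : (PowerSeries.map (Nat.castRingHom ℚ)) catalanSeries =
      1 + X * (PowerSeries.map (Nat.castRingHom ℚ)) catalanSeries ^ 2 := by
    have := congrArg (PowerSeries.map (Nat.castRingHom ℚ)) catalanSeries_sq_mul_X_add_one
    rw [map_add, map_mul, map_pow, map_X, map_one] at this
    linear_combination -this
  refine ⟨substAlgHom ha ((PowerSeries.map (Nat.castRingHom ℚ)) catalanSeries), ?_⟩
  conv_lhs => rw [hc, map_add, map_mul, map_pow, map_one, substAlgHom_X]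

end ClosedForms

/-! ### Passage to Laurent series and conclusion. -/

theorem ne_zero_of_constantCoeff {f : PowerSeries ℚ} (h : PowerSeries.constantCoeff f ≠ 0) :
    f ≠ 0 := by
  rintro rfl
  simp at h

open PowerSeries in
/-- Passage from an identity of power series to one of quotients of Laurent series. -/
theorem coe_eq_of_mul_eq {A S : PowerSeries ℚ}
    (h : 2 * X ^ 2 * (1 - X) ^ 2 * (1 - 3 * X + X ^ 2) * A =
      (1 - X) ^ 2 * (1 - X ^ 2) * S -
        (1 - 3 * X - 2 * X ^ 2 + 14 * X ^ 3 - 15 * X ^ 4 + 3 * X ^ 5))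
    {t : LaurentSeries ℚ} (ht : t = ((X : PowerSeries ℚ) : LaurentSeries ℚ)) :
    (A : LaurentSeries ℚ) =
      ((1 - t ^ 2) * (S : LaurentSeries ℚ)) / (2 * t ^ 2 * (1 - 3 * t + t ^ 2)) -
      (1 - 3 * t - 2 * t ^ 2 + 14 * t ^ 3 - 15 * t ^ 4 + 3 * t ^ 5) /
        (2 * t ^ 2 * (1 - t) ^ 2 * (1 - 3 * t + t ^ 2)) := by
  set φ : PowerSeries ℚ →+* LaurentSeries ℚ := HahnSeries.ofPowerSeries ℤ ℚ with hφ
  have hinj : Function.Injective φ := HahnSeries.ofPowerSeries_injective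
  have hne : ∀ f : PowerSeries ℚ, f ≠ 0 → φ f ≠ 0 := fun f hf =>
    (map_ne_zero_iff φ hinj).2 hf
  have htφ : φ X = t := ht.symm
  have h0 : t ≠ 0 := htφ ▸ hne X X_ne_zero
  have h1 : 1 - t ≠ 0 := by
    have := hne (1 - X) (ne_zero_of_constantCoeff (by simp))
    rwa [map_sub, map_one, htφ] at this
  have h2 : 1 - 3 * t + t ^ 2 ≠ 0 := by
    have := hne (1 - 3 * X + X ^ 2) (ne_zero_of_constantCoeff (by simp))
    rwa [map_add, map_sub, map_mul, map_pow, map_one, map_ofNat, htφ] at this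
  have h' := congrArg φ h
  simp only [map_add, map_sub, map_mul, map_pow, map_one, map_ofNat, htφ] at h'
  show φ A = ((1 - t ^ 2) * φ S) / _ - _
  have h3 : (2 : LaurentSeries ℚ) ≠ 0 := by
    have := hne 2 (ne_zero_of_constantCoeff (by rw [map_ofNat]; norm_num))
    rwa [map_ofNat] at this
  have h4 : 2 * t ^ 2 * (1 - 3 * t + t ^ 2) ≠ 0 :=
    mul_ne_zero (mul_ne_zero h3 (pow_ne_zero 2 h0)) h2
  have h5 : 2 * t ^ 2 * (1 - t) ^ 2 * (1 - 3 * t + t ^ 2) ≠ 0 :=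
    mul_ne_zero (mul_ne_zero (mul_ne_zero h3 (pow_ne_zero 2 h0)) (pow_ne_zero 2 h1)) h2
  rw [div_sub_div _ _ h4 h5, eq_div_iff (mul_ne_zero h4 h5)]
  linear_combination (2 * t ^ 2 * (1 - 3 * t + t ^ 2)) * h'

theorem mainTheorem12 :
    (∃ S : PowerSeries ℚ,
      -- `S` is the square root of `(1 - t)(1 - t - 4t²)` with constant term `1`
      PowerSeries.constantCoeff S = 1 ∧
      S ^ 2 = (1 - PowerSeries.X) * (1 - PowerSeries.X - 4 * PowerSeries.X ^ 2) ∧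
      -- the closed form, an identity of quotients in the field of formal Laurent series
      ∀ t s : LaurentSeries ℚ, t = ((PowerSeries.X : PowerSeries ℚ) : LaurentSeries ℚ) →
        s = (S : LaurentSeries ℚ) →
        ((avoidGenFun {[1, 1, 2, 3], [1, 2, 2, 2]} : PowerSeries ℚ) : LaurentSeries ℚ) =
          ((1 - t ^ 2) * s) / (2 * t ^ 2 * (1 - 3 * t + t ^ 2)) -
          (1 - 3 * t - 2 * t ^ 2 + 14 * t ^ 3 - 15 * t ^ 4 + 3 * t ^ 5) /
            (2 * t ^ 2 * (1 - t) ^ 2 * (1 - 3 * t + t ^ 2)) ∧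
        ((avoidGenFun {[1, 1, 2, 3], [1, 2, 1, 1]} : PowerSeries ℚ) : LaurentSeries ℚ) =
          ((1 - t ^ 2) * s) / (2 * t ^ 2 * (1 - 3 * t + t ^ 2)) -
          (1 - 3 * t - 2 * t ^ 2 + 14 * t ^ 3 - 15 * t ^ 4 + 3 * t ^ 5) /
            (2 * t ^ 2 * (1 - t) ^ 2 * (1 - 3 * t + t ^ 2))) ∧
    WilfEquivalent {[1, 1, 2, 3], [1, 2, 1, 1]} {[1, 1, 2, 3], [1, 2, 2, 2]} := by
  have hr : (1 - PowerSeries.X : PowerSeries ℚ)⁻¹ * (1 - PowerSeries.X) = 1 :=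
    PowerSeries.inv_mul_cancel _ (by simp)
  have hd : (1 - 3 * PowerSeries.X + PowerSeries.X ^ 2 : PowerSeries ℚ)⁻¹ *
      (1 - 3 * PowerSeries.X + PowerSeries.X ^ 2) = 1 :=
    PowerSeries.inv_mul_cancel _ (by simp)
  generalize (1 - PowerSeries.X : PowerSeries ℚ)⁻¹ = r at hr
  generalize (1 - 3 * PowerSeries.X + PowerSeries.X ^ 2 : PowerSeries ℚ)⁻¹ = d at hd
  obtain ⟨v, hv⟩ := exists_catalan_kernel r
  have hA := avoidGenFun_triple hr hv hd
  have hB := avoidGenFun_return hr hv hd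
  -- Solving the quadratic for `v` gives `1 - 2 * X ^ 2 * r * v` as the root of `1 - 4 * X ^ 2 * r`;
  -- multiplication by `1 - X` gives this `S`.
  refine ⟨⟨1 - PowerSeries.X - 2 * PowerSeries.X ^ 2 * v, by simp, ?_, ?_⟩, fun n => ?_⟩
  · linear_combination 4 * PowerSeries.X ^ 2 * ((PowerSeries.X - 1) * hv -
      PowerSeries.X ^ 2 * v ^ 2 * hr)
  · rintro t s ht rfl
    exact ⟨coe_eq_of_mul_eq hA ht, coe_eq_of_mul_eq hB ht⟩
  · have h : avoidGenFun {[1, 1, 2, 3], [1, 2, 1, 1]} =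
        avoidGenFun {[1, 1, 2, 3], [1, 2, 2, 2]} := by
      -- Both series have the same product with the same nonzero factor.
      refine mul_left_cancel₀ ?_ (hB.trans hA.symm)
      refine mul_ne_zero (mul_ne_zero (mul_ne_zero (ne_zero_of_constantCoeff ?_) ?_) ?_) ?_
      · rw [map_ofNat]
        norm_num
      · exact pow_ne_zero _ PowerSeries.X_ne_zero
      · exact pow_ne_zero _ (ne_zero_of_constantCoeff (by simp))
      · exact ne_zero_of_constantCoeff (by simp)
    have := congrArg (PowerSeries.coeff n) h
    simpa [avoidGenFun] using this
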